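/- Let $S$ be a connected translation surface (a surface with an atlas whose coordinate changes are locally translations of $\mathbb{R}^2$), $\overline{S}$ its metric completion with respect to the flat metric, and $\Sigma=\overline{S}\setminus S$ its set of singularities. Suppose that $S$ is tame, i.e. every point of $\Sigma$ is a cone point, of angle $2\pi n$ with $n\ge 1$ (so removable punctures are allowed) or of infinite angle: it has the same neighbourhood as the ramification point of an $n$-fold or infinite cyclic branched covering of a Euclidean disc. A *saddle connection* is a geodesic of finite length that joins two points of $\Sigma$ and lies otherwise in $S$; the vector of $\mathbb{R}^2$ obtained by developing it is a *holonomy vector*. The *field of cross ratios* $K_{cr}(S)$ is the subfield of $\mathbb{R}$ generated by the cross ratios $$(v_1,v_2;v_3,v_4)=\frac{(r_1-r_3)(r_2-r_4)}{(r_2-r_3)(r_1-r_4)}$$ of pairwise non-parallel holonomy vectors $v_1,\dots,v_4$, where $r_i\in\mathbb{R}\cup\{\infty\}$ is the slope of $v_i$ (factors containing an infinite slope are omitted). Let $\Lambda\subset\mathbb{R}^2$ be the image of $H_1(\overline{S},\Sigma;\mathbb{Z})$ under the holonomy map and $n$ the dimension of the real span of $\Lambda$. The *field of saddle connections* $K_{sc}(S)$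 is the smallest subfield $k$ of $\mathbb{R}$ such that the $k$-span of $\Lambda$ has dimension $n$ over $k$. Suppose that $\overline{S}$ has a triangulation by countably many triangles $\Delta_k$ such that the set of vertices equals $\Sigma$ and all $\Delta_k$ are geodesic triangles for the flat metric. (Here, as usual for flat surfaces, each triangle is the image of a non-degenerate Euclidean triangle under a continuous map that is, away from the vertices, a local translation into $S$; interiors of triangles are embedded and disjoint from all other triangles, open edges are embedded and pairwise equal or disjoint, vertices of one triangle may coincide in $\overline{S}$, and the triangulation is locally finite away from the vertices.) Then $S$ has four pairwise non-parallel holonomy vectors, so that $K_{cr}(S)$ makes sense, and $$K_{cr}(S)=K_{sc}(S).$$ -/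

import Mathlib

open Filter Topology UniformSpace
open scoped unitInterval

noncomputable section

namespace FlatSurface

/-- The Euclidean plane `ℝ²`. -/
abbrev Plane : Type := EuclideanSpace ℝ (Fin 2)

/-! ### Translation surfaces -/

/-- The pregroupoid of maps between open subsets of the plane that are locally translations. -/
def translationPregroupoid : Pregroupoid Plane where
  property f s := ∀ x ∈ s, ∃ v : Plane, ∀ᶠ y in 𝓝[s] x, f y = y + v
  comp := by
    intro f g u v hf hg hu hv huv x hx
    obtain ⟨a, ha⟩ := hf x hx.1
    obtain ⟨b, hb⟩ := hg (f x) hx.2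
    have hfx : f x = x + a := ha.self_of_nhdsWithin hx.1
    have hb' : ∀ᶠ z in 𝓝 (f x), g z = z + b := by
      rwa [hv.nhdsWithin_eq hx.2] at hb
    have hT : Tendsto (fun y : Plane => y + a) (𝓝 x) (𝓝 (f x)) := by
      rw [hfx]
      exact (continuous_id.add continuous_const).tendsto x
    refine ⟨a + b, ?_⟩
    have h1 : ∀ᶠ y in 𝓝[u ∩ f ⁻¹' v] x, f y = y + a :=
      ha.filter_mono (nhdsWithin_mono _ Set.inter_subset_left)
    have h2 : ∀ᶠ y in 𝓝[u ∩ f ⁻¹' v] x, g (y + a) = y + a + b :=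
      (hT.eventually hb').filter_mono nhdsWithin_le_nhds
    filter_upwards [h1, h2] with y hy1 hy2
    simp only [Function.comp_apply]
    rw [hy1, hy2, add_assoc]
  id_mem := fun x _ => ⟨0, Eventually.of_forall fun y => by simp⟩
  locality := by
    intro f u hu h x hx
    obtain ⟨v, hv, hxv, hfv⟩ := h x hx
    obtain ⟨a, ha⟩ := hfv x ⟨hx, hxv⟩
    refine ⟨a, ?_⟩
    rwa [nhdsWithin_inter_of_mem' (mem_nhdsWithin_of_mem_nhds (hv.mem_nhds hxv))] at ha
  congr := by
    intro f g u hu hfg hf x hx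
    obtain ⟨a, ha⟩ := hf x hx
    refine ⟨a, ?_⟩
    filter_upwards [ha, self_mem_nhdsWithin] with y hy hyu
    rw [hfg y hyu, hy]

/-- The structure groupoid of local homeomorphisms of the plane that are locally translations. -/
def translationGroupoid : StructureGroupoid Plane :=
  translationPregroupoid.groupoid

section Surface

variable {S : Type*}

/-- `δ` is a development into the plane of the path `γ`: near every time it agrees, up to a
translation, with `γ` read in a chart. -/
def IsDevelopment [TopologicalSpace S] [ChartedSpace Plane S]
    (γ : C(I, S)) (δ : C(I, Plane)) : Prop :=
  ∀ t : I, ∃ v : Plane, ∀ᶠ s in 𝓝 t, chartAt Plane (γ t) (γ s) = δ s + v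

/-- A connected translation surface with its flat metric: a connected two-dimensional manifold
with an atlas whose coordinate changes are locally translations, whose distance is the infimum of
the lengths of the paths between two points. As coordinate changes are Euclidean isometries, the
length of a path is the length (total variation) of a development of it. -/
class TranslationSurface (S : Type*) [MetricSpace S] [ChartedSpace Plane S] : Prop
    extends ConnectedSpace S, HasGroupoid S translationGroupoid where
  edist_eq : ∀ x y : S, edist x y =
    ⨅ (γ : Path x y) (δ : C(I, Plane)) (_ : IsDevelopment γ.toContinuousMap δ),
      eVariationOn δ Set.univ

/-! ### The metric completion and its singularities -/

/-- The set `Σ` of singularities: the points of the metric completion that are not in `S`. -/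
def singularSet (S : Type*) [MetricSpace S] : Set (Completion S) :=
  (Set.range ((↑) : S → Completion S))ᶜ

/-- The point of the plane with polar coordinates `(r, θ)`. -/
def polar (r θ : ℝ) : Plane := !₂[r * Real.cos θ, r * Real.sin θ]

/-- `p` is a cone point of angle `2πn` (`n ≥ 1`) or of infinite angle (`n = 0`): a punctured ball
around `p` lies in `S` and has polar coordinates `(r, θ)`, with `r` the distance from `p` and `θ`
a real number modulo `2πn` (a real number if `n = 0`), in which the translation structure is the
pullback of that of the plane under `(r, θ) ↦ (r cos θ, r sin θ)`. In other words, `p` has the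
neighbourhood of the ramification point of the `n`-fold, respectively infinite, cyclic covering
of a Euclidean disc. -/
def IsConePoint [MetricSpace S] [ChartedSpace Plane S] (p : Completion S) (n : ℕ) : Prop :=
  ∃ ε : ℝ, 0 < ε ∧ ∃ c : ℝ → ℝ → S,
    (∀ r ∈ Set.Ioo 0 ε, ∀ θ : ℝ, dist (c r θ : Completion S) p = r) ∧
    Metric.ball p ε =
      insert p {q | ∃ r ∈ Set.Ioo 0 ε, ∃ θ : ℝ, (c r θ : Completion S) = q} ∧
    (∀ r ∈ Set.Ioo 0 ε, ∀ r' ∈ Set.Ioo 0 ε, ∀ θ θ' : ℝ,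
      c r θ = c r' θ' ↔ r = r' ∧ ∃ m : ℤ, θ - θ' = m * (n * (2 * Real.pi))) ∧
    ∀ r ∈ Set.Ioo 0 ε, ∀ θ : ℝ, ∃ v : Plane, ∀ᶠ q : ℝ × ℝ in 𝓝 (r, θ),
      c q.1 q.2 ∈ (chartAt Plane (c r θ)).source ∧
        chartAt Plane (c r θ) (c q.1 q.2) = polar q.1 q.2 + v

/-- A translation surface is tame if its metric completion is obtained by adding cone points of
finite or infinite angle. -/
def IsTame (S : Type*) [MetricSpace S] [ChartedSpace Plane S] : Prop :=
  ∀ p ∈ singularSet S, ∃ n : ℕ, IsConePoint p n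

/-! ### Saddle connections and the field of cross ratios -/

/-- `v` is a holonomy vector: there is a saddle connection with development `t ↦ t • v`, that is,
a geodesic that lies in `S` except for its two endpoints, which are singularities. -/
def IsHolonomyVector (S : Type*) [MetricSpace S] [ChartedSpace Plane S] (v : Plane) : Prop :=
  v ≠ 0 ∧ ∃ γ : C(I, Completion S), γ 0 ∈ singularSet S ∧ γ 1 ∈ singularSet S ∧
    ∀ t : I, t ≠ 0 → t ≠ 1 → ∃ x : S, γ t = (x : Completion S) ∧
      ∃ w : Plane, ∀ᶠ s : I in 𝓝 t, ∃ y ∈ (chartAt Plane x).source,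
        γ s = (y : Completion S) ∧ chartAt Plane x y = (s : ℝ) • v + w

/-- The determinant of two vectors of the plane. It vanishes iff they are parallel. -/
def det (v w : Plane) : ℝ := v 0 * w 1 - v 1 * w 0

/-- The cross ratio `(v₁, v₂; v₃, v₄)` of four vectors, that is, the cross ratio
`(r₁ - r₃)(r₂ - r₄) / ((r₂ - r₃)(r₁ - r₄))` of their slopes, written homogeneously so that it
covers infinite slopes. -/
def crossRatio (v₁ v₂ v₃ v₄ : Plane) : ℝ :=
  (det v₁ v₃ * det v₂ v₄) / (det v₂ v₃ * det v₁ v₄)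

theorem crossRatio_eq_slopes (v₁ v₂ v₃ v₄ : Plane)
    (h₁ : v₁ 0 ≠ 0) (h₂ : v₂ 0 ≠ 0) (h₃ : v₃ 0 ≠ 0) (h₄ : v₄ 0 ≠ 0) :
    crossRatio v₁ v₂ v₃ v₄ =
      ((v₁ 1 / v₁ 0 - v₃ 1 / v₃ 0) * (v₂ 1 / v₂ 0 - v₄ 1 / v₄ 0)) /
        ((v₂ 1 / v₂ 0 - v₃ 1 / v₃ 0) * (v₁ 1 / v₁ 0 - v₄ 1 / v₄ 0)) := by
  have h : ∀ v w : Plane, v 0 ≠ 0 → w 0 ≠ 0 →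
      v 1 / v 0 - w 1 / w 0 = -det v w / (v 0 * w 0) := by
    intro v w hv hw
    unfold det
    field_simp
    ring
  rw [h _ _ h₁ h₃, h _ _ h₂ h₄, h _ _ h₂ h₃, h _ _ h₁ h₄, crossRatio, div_mul_div_comm,
    div_mul_div_comm, show v₁ 0 * v₃ 0 * (v₂ 0 * v₄ 0) = v₂ 0 * v₃ 0 * (v₁ 0 * v₄ 0) by ring,
    div_div_div_cancel_right₀ (by positivity), neg_mul_neg, neg_mul_neg]

/-- Four pairwise non-parallel holonomy vectors. -/
def IsHolonomyQuadruple (S : Type*) [MetricSpace S] [ChartedSpace Plane S]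
    (v : Fin 4 → Plane) : Prop :=
  (∀ i, IsHolonomyVector S (v i)) ∧ ∀ i j, i ≠ j → det (v i) (v j) ≠ 0

/-- The field of cross ratios of saddle connections `K_cr(S)`: the subfield of `ℝ` generated by
the cross ratios of four pairwise non-parallel holonomy vectors. -/
def crossRatioField (S : Type*) [MetricSpace S] [ChartedSpace Plane S] : Subfield ℝ :=
  Subfield.closure
    {x | ∃ v : Fin 4 → Plane, IsHolonomyQuadruple S v ∧
      x = crossRatio (v 0) (v 1) (v 2) (v 3)}

/-! ### Holonomy of relative homology and the field of saddle connections -/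

/-- `D` is a flat coordinate (not necessarily injective) on the subset `U` of the completion:
continuous on `U`, and on the part of `U` in `S` locally a chart followed by a translation. -/
def IsFlatCoordinate [MetricSpace S] [ChartedSpace Plane S]
    (D : Completion S → Plane) (U : Set (Completion S)) : Prop :=
  ContinuousOn D U ∧ ∀ x : S, (x : Completion S) ∈ U →
    ∃ v : Plane, ∀ᶠ y : S in 𝓝 x, D (y : Completion S) = chartAt Plane x y + v

/-- `δ` is a development into the plane of the path `γ` in the completion, along the continuous
extension of the developing map to the completion. -/
def IsExtendedDevelopment [MetricSpace S] [ChartedSpace Plane S]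
    (γ : C(I, Completion S)) (δ : C(I, Plane)) : Prop :=
  ∀ t : I, ∃ (U : Set (Completion S)) (D : Completion S → Plane),
    IsOpen U ∧ γ t ∈ U ∧ IsFlatCoordinate D U ∧ ∀ᶠ s in 𝓝 t, δ s = D (γ s)

open Classical in
/-- The holonomy of a path in the completion: the difference of the endpoints of a development.
On a tame surface every path has a development, which is unique up to translation. -/
def holonomy [MetricSpace S] [ChartedSpace Plane S] (γ : C(I, Completion S)) : Plane :=
  if h : ∃ v : Plane, ∃ δ : C(I, Plane), IsExtendedDevelopment γ δ ∧ v = δ 1 - δ 0 then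
    h.choose
  else 0

/-- Singular 1-chains of a space, with integer coefficients. -/
abbrev Chain (X : Type*) [TopologicalSpace X] : Type _ := C(I, X) →₀ ℤ

/-- The boundary of singular 1-chains. -/
def boundary (X : Type*) [TopologicalSpace X] : Chain X →+ (X →₀ ℤ) :=
  Finsupp.liftAddHom fun γ : C(I, X) =>
    Finsupp.singleAddHom (γ 1) - Finsupp.singleAddHom (γ 0)

/-- The relative singular 1-cycles of the pair `(X, A)`: chains whose boundary is a chain in `A`.
Every class of the relative homology group `H₁(X, A; ℤ)` is represented by such a cycle. -/
def relativeCycles (X : Type*) [TopologicalSpace X] (A : Set X) : AddSubgroup (Chain X) :=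
  (Finsupp.supported ℤ ℤ A).toAddSubgroup.comap (boundary X)

/-- The holonomy of singular 1-chains of the completion. -/
def chainHolonomy (S : Type*) [MetricSpace S] [ChartedSpace Plane S] :
    Chain (Completion S) →+ Plane :=
  Finsupp.liftAddHom fun γ => (zmultiplesHom Plane) (holonomy γ)

/-- The image in `ℝ²` of the relative homology `H₁(S̄, Σ; ℤ)` under the holonomy map. The holonomy
of a class is the holonomy of any relative cycle that represents it. -/
def relativeHolonomy (S : Type*) [MetricSpace S] [ChartedSpace Plane S] : AddSubgroup Plane :=
  (relativeCycles (Completion S) (singularSet S)).map (chainHolonomy S)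

/-- The condition on a subfield `k` of `ℝ` that `k • Λ ≅ kⁿ`, where `n` is the dimension of the
smallest real subspace of the plane containing `Λ`. -/
def IsCoefficientField (Λ : AddSubgroup Plane) (k : Subfield ℝ) : Prop :=
  Module.rank k (Submodule.span k (Λ : Set Plane)) =
    Module.rank ℝ (Submodule.span ℝ (Λ : Set Plane))

/-- The smallest subfield `k` of `ℝ` such that `k • Λ ≅ kⁿ`, where `n` is the dimension of the
smallest real subspace of the plane containing `Λ`. -/
def coefficientField (Λ : AddSubgroup Plane) : Subfield ℝ :=
  sInf {k | IsCoefficientField Λ k}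

theorem isCoefficientField_iff {Λ : AddSubgroup Plane} {k : Subfield ℝ} {b : Set Plane}
    (hb : b ⊆ (Λ : Set Plane)) (hspan : (Λ : Set Plane) ⊆ Submodule.span ℝ b)
    (hli : LinearIndependent ℝ ((↑) : b → Plane)) :
    IsCoefficientField Λ k ↔ (Λ : Set Plane) ⊆ Submodule.span k b := by
  have hR : Submodule.span ℝ (Λ : Set Plane) = Submodule.span ℝ b :=
    le_antisymm (Submodule.span_le.2 hspan) (Submodule.span_mono hb)
  have hlik : LinearIndependent k ((↑) : b → Plane) := hli.restrict_scalars' k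
  have hrk : Module.rank k (Submodule.span k b) = Cardinal.mk b := rank_span_set hlik
  have hrR : Module.rank ℝ (Submodule.span ℝ b) = Cardinal.mk b := rank_span_set hli
  have hfin : Cardinal.mk b < Cardinal.aleph0 := by
    rw [← hrR]; exact Module.rank_lt_aleph0 _ _
  have hle : Submodule.span k b ≤ Submodule.span k (Λ : Set Plane) := Submodule.span_mono hb
  unfold IsCoefficientField
  rw [hR, hrR]
  constructor
  · intro h
    have : FiniteDimensional k (Submodule.span k (Λ : Set Plane)) :=
      Module.rank_lt_aleph0_iff.1 (h ▸ hfin)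
    have := Submodule.eq_of_le_of_finrank_eq hle (by
      unfold Module.finrank; rw [hrk, h])
    rw [this]
    exact Submodule.subset_span
  · intro h
    rw [le_antisymm (Submodule.span_le.2 h) hle, hrk]

/-- The field `coefficientField Λ` is indeed the smallest element. -/
theorem isLeast_coefficientField (Λ : AddSubgroup Plane) :
    IsLeast {k | IsCoefficientField Λ k} (coefficientField Λ) := by
  refine ⟨?_, fun k hk => sInf_le hk⟩
  obtain ⟨b, hb, hspan, hli⟩ := exists_linearIndependent ℝ (Λ : Set Plane)
  have hsub : (Λ : Set Plane) ⊆ Submodule.span ℝ b := by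
    rw [hspan]; exact Submodule.subset_span
  rw [Set.mem_ofPred_eq, isCoefficientField_iff hb hsub hli]
  intro v hv
  obtain ⟨c, hc⟩ := (Finsupp.mem_span_iff_linearCombination ℝ b v).1 (hsub hv)
  have hmem : ∀ i, c i ∈ coefficientField Λ := by
    intro i
    rw [coefficientField, Subfield.mem_sInf]
    intro k hk
    obtain ⟨d, hd⟩ := (Finsupp.mem_span_iff_linearCombination k b v).1
      ((isCoefficientField_iff hb hsub hli).1 hk hv)
    have hcd : c = d.mapRange (fun x : k => (x : ℝ)) rfl := by
      apply hli
      rw [hc, ← hd, Finsupp.linearCombination_apply, Finsupp.linearCombination_apply,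
        Finsupp.sum_mapRange_index (by simp)]
      rfl
    rw [hcd]
    exact (d i).2
  rw [← hc, Finsupp.linearCombination_apply]
  refine Submodule.sum_mem _ fun i _ => ?_
  exact Submodule.smul_mem _ (⟨c i, hmem i⟩ : coefficientField Λ) (Submodule.subset_span i.2)

/-- The segment field, or field of saddle connections, `K_sc(S)`. -/
def segmentField (S : Type*) [MetricSpace S] [ChartedSpace Plane S] : Subfield ℝ :=
  coefficientField (relativeHolonomy S)

/-! ### Geodesic triangulations -/

/-- A triangulation of the completion by geodesic triangles with vertex set `Σ`.
Each triangle is the image of a non-degenerate Euclidean triangle under a map that is continuous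
and, away from the vertices, a local translation into `S`. As usual for flat surfaces, the three
vertices of a triangle need not be distinct points of the completion, and two triangles may share
more than one edge. Infinitely many triangles may meet at a vertex (as they must at a singularity
of infinite angle), but away from the vertices the triangulation is locally finite. -/
structure GeodesicTriangulation (S : Type*) [MetricSpace S] [ChartedSpace Plane S]
    (ι : Type*) where
  /-- The vertices of the Euclidean triangles. -/
  vert : ι → Fin 3 → Plane
  /-- The maps of the Euclidean triangles to the completion (only their values on the triangles
  matter). -/
  map : ι → Plane → Completion S
  affineIndependent : ∀ k, AffineIndependent ℝ (vert k)
  continuousOn : ∀ k, ContinuousOn (map k) (convexHull ℝ (Set.range (vert k)))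
  /-- Away from the vertices, the triangles are flat and lie in `S`. -/
  flat : ∀ k, ∀ z ∈ convexHull ℝ (Set.range (vert k)), z ∉ Set.range (vert k) →
    ∃ x : S, map k z = (x : Completion S) ∧ ∃ v : Plane,
      ∀ᶠ w in 𝓝[convexHull ℝ (Set.range (vert k))] z, ∃ y ∈ (chartAt Plane x).source,
        map k w = (y : Completion S) ∧ chartAt Plane x y = w + v
  /-- The triangles cover the completion. -/
  cover : ∀ p : Completion S, ∃ k, ∃ z ∈ convexHull ℝ (Set.range (vert k)), map k z = p
  /-- The set of vertices is the set of singularities. -/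
  vertices : {p | ∃ k j, map k (vert k j) = p} = singularSet S
  /-- Interiors of triangles are embedded and disjoint from all other triangles and edges. -/
  interior_inj : ∀ k l, ∀ z ∈ interior (convexHull ℝ (Set.range (vert k))),
    ∀ w ∈ convexHull ℝ (Set.range (vert l)), map k z = map l w → k = l ∧ z = w
  /-- Open edges are embedded. -/
  edge_inj : ∀ k j, Set.InjOn (map k) (openSegment ℝ (vert k (j + 1)) (vert k (j + 2)))
  /-- Two open edges are equal or disjoint. -/
  edge_eq_or_disjoint : ∀ k j l m,
    map k '' openSegment ℝ (vert k (j + 1)) (vert k (j + 2)) =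
        map l '' openSegment ℝ (vert l (m + 1)) (vert l (m + 2)) ∨
      Disjoint (map k '' openSegment ℝ (vert k (j + 1)) (vert k (j + 2)))
        (map l '' openSegment ℝ (vert l (m + 1)) (vert l (m + 2)))
  /-- Away from the vertices, the triangulation is locally finite. -/
  locallyFinite : ∀ x : S, ∃ U ∈ 𝓝 (x : Completion S),
    {k | (map k '' convexHull ℝ (Set.range (vert k)) ∩ U).Nonempty}.Finite

end Surface

end FlatSurface

end

noncomputable section

namespace FlatSurface

/-! ### Locally constant functions -/

/-! The sides of the triangles are saddle connections. Fix one triangle and let `a`, `b` be two of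
its sides, so that `b - a` is, up to sign, the third. A subfield `k` satisfies the rank condition
exactly when `Λ ⊆ k a + k b`. Both inclusions are therefore statements about coordinates in the
basis `a`, `b`.

For `K_cr ⊆ K_sc`: holonomy vectors have coordinates in `K_sc`, so each of their determinants is a
`K_sc`-multiple of `det a b`, and this factor cancels in a cross ratio
(`crossRatio_mem_of_mem_span`).

For `K_sc ⊆ K_cr`: the directions `a`, `b`, `b - a` are a projective frame, so the cross ratio with
a fourth holonomy vector places its direction over `K_cr` (`IsHolonomyVector.exists_eq_smul`). This
controls directions, not lengths. But a triangle whose three sides have directions over `K_cr` and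
which has one side in `V = K_cr a + K_cr b` has all its sides in `V` (`vert_sub_vert_mem_span`).
Neighbouring triangles have an edge in common up to translation (`edge_translate`), and `S` is
connected, so all edges lie in `V` (`forall_of_shared_edge`).

It remains to see that the edges generate all relative holonomy (`relativeHolonomy_le`). In place of
simplicial homology, every point receives a position in the plane modulo the group generated by the
edges. Position differs from any flat coordinate by a local constant and vanishes on `Σ`. Hence the
holonomy of a path is, modulo edges, the difference of the positions of its endpoints, and relative
cycles have holonomy in the edge group. At singularities the argument uses that a cone point has
connected punctured balls.

Four pairwise non-parallel holonomy vectors come from two adjacent triangles: the sides of one, and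
either a side of the other or, if the two form a parallelogram, its second diagonal. -/

theorem eq_of_eventually_of_isPreconnected {Y α : Type*} [TopologicalSpace Y] {A : Set Y}
    (hA : IsPreconnected A) {f : Y → α} (h : ∀ x ∈ A, ∀ᶠ y in 𝓝[A] x, f y = f x)
    {x y : Y} (hx : x ∈ A) (hy : y ∈ A) : f x = f y := by
  let : TopologicalSpace α := ⊥
  have : DiscreteTopology α := ⟨rfl⟩
  refine hA.constant (fun z hz => ?_) hx hy
  have : f =ᶠ[𝓝[A] z] fun _ => f z := h z hz
  exact (tendsto_const_nhds.congr' this.symm)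

/-- Continuity extends the constant value from `A` to its limit points. This is how identities pass
to a cone point from its punctured ball, and to the initial time of a path. -/
theorem eq_of_eventually_of_subset_closure {Y α : Type*} [TopologicalSpace Y]
    [TopologicalSpace α] [T2Space α] {A B : Set Y} (hA : IsPreconnected A) {f : Y → α}
    (h : ∀ x ∈ A, ∀ᶠ y in 𝓝[A] x, f y = f x) (hf : ContinuousOn f B) (hAB : A ⊆ B)
    (hBA : B ⊆ closure A) {x y : Y} (hx : x ∈ B) (hy : y ∈ B) : f x = f y := by
  rcases A.eq_empty_or_nonempty with rfl | ⟨a, ha⟩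
  · simpa using hBA hx
  have key : ∀ z ∈ B, f z = f a := by
    intro z hz
    have hne : (𝓝[A] z).NeBot := mem_closure_iff_nhdsWithin_neBot.1 (hBA hz)
    have h1 : Tendsto f (𝓝[A] z) (𝓝 (f z)) := (hf z hz).mono_left (nhdsWithin_mono _ hAB)
    have h2 : Tendsto f (𝓝[A] z) (𝓝 (f a)) := by
      refine tendsto_const_nhds.congr' ?_
      filter_upwards [self_mem_nhdsWithin] with w hw
      exact eq_of_eventually_of_isPreconnected hA h ha hw
    exact tendsto_nhds_unique h1 h2
  rw [key x hx, key y hy]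

/-! ### Preimages of compact sets -/

/-- A tube argument: near a point of `K` over `p` the hypothesis applies, near any other point of
`K` the values of `f` stay away from `p`, and compactness makes the neighbourhood of `p` uniform. -/
theorem eventually_of_preimage_isCompact {Y X : Type*} [TopologicalSpace Y] [TopologicalSpace X]
    [T2Space X] {K : Set Y} (hK : IsCompact K) {f : Y → X} (hf : ContinuousOn f K) {p : X}
    {P : X → Y → Prop} (h : ∀ z ∈ K, f z = p → ∀ᶠ w in 𝓝[K] z, P (f w) w) :
    ∀ᶠ q in 𝓝 p, ∀ w ∈ K, f w = q → P q w := by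
  suffices H : ∀ᶠ q in 𝓝 p, ∀ w ∈ K, (w ∈ K → f w = q → P q w) by
    filter_upwards [H] with q hq w hw using hq w hw hw
  refine hK.eventually_forall_of_forall_eventually fun z hz => ?_
  rw [nhds_prod_eq]
  by_cases hzp : f z = p
  · have h1 := eventually_nhdsWithin_iff.1 (h z hz hzp)
    filter_upwards [h1.prod_inr (𝓝 p)] with a ha haK hq
    rw [← hq]
    exact ha haK
  · obtain ⟨u, v, hu, hv, hzu, hpv, huv⟩ := t2_separation hzp
    have h1 : ∀ᶠ w in 𝓝[K] z, f w ∈ u := (hf z hz).eventually (hu.mem_nhds hzu)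
    have h2 := eventually_nhdsWithin_iff.1 h1
    have h3 : ∀ᶠ q in 𝓝 p, q ∈ v := hv.mem_nhds hpv
    filter_upwards [h2.prod_inr (𝓝 p), h3.prod_inl (𝓝 z)] with a ha hav haK hq
    exact absurd (hq ▸ hav) (Set.disjoint_left.1 huv (ha haK))

/-! ### Polar coordinates -/

theorem continuous_polar : Continuous fun q : ℝ × ℝ => polar q.1 q.2 := by
  unfold polar
  fun_prop

theorem norm_polar {r : ℝ} (hr : 0 ≤ r) (θ : ℝ) : ‖polar r θ‖ = r := by
  rw [EuclideanSpace.norm_eq, Fin.sum_univ_two]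
  simp only [polar, Real.norm_eq_abs, sq_abs]
  have : (r * Real.cos θ) ^ 2 + (r * Real.sin θ) ^ 2 = r ^ 2 := by
    have := Real.sin_sq_add_cos_sq θ
    linear_combination r ^ 2 * this
  simp [this, Real.sqrt_sq hr]

theorem polar_eq_of_sub {r θ θ' : ℝ} {m : ℤ} (h : θ - θ' = m * (2 * Real.pi)) :
    polar r θ = polar r θ' := by
  have : θ = θ' + m * (2 * Real.pi) := by linarith
  rw [this, polar, polar, Real.cos_add_int_mul_two_pi, Real.sin_add_int_mul_two_pi]

/-- The polar coordinates have continuous local sections away from the origin. -/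
theorem exists_polar_section {r : ℝ} (hr : 0 < r) (θ : ℝ) :
    ∃ g : Plane → ℝ × ℝ, ContinuousAt g (polar r θ) ∧ g (polar r θ) = (r, θ) ∧
      ∀ u, polar (g u).1 (g u).2 = u := by
  -- Rotation by `-θ` moves the base point to the positive real axis, where `Complex.arg` is
  -- continuous.
  let w : Plane → ℂ := fun u => ((u 0 : ℂ) + (u 1 : ℂ) * Complex.I) *
    Complex.exp (-(θ * Complex.I))
  have hw : Continuous w := by fun_prop
  have hwp : w (polar r θ) = r := by
    have : ((r * Real.cos θ : ℝ) : ℂ) + ((r * Real.sin θ : ℝ) : ℂ) * Complex.I =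
        r * Complex.exp (θ * Complex.I) := by
      rw [Complex.exp_mul_I]; push_cast; ring
    simp only [w, polar]
    simp only [Matrix.cons_val_zero, Matrix.cons_val_one]
    rw [this, mul_assoc, ← Complex.exp_add]
    simp
  refine ⟨fun u => (‖w u‖, θ + Complex.arg (w u)), ?_, ?_, ?_⟩
  · refine ContinuousAt.prodMk hw.norm.continuousAt (continuousAt_const.add ?_)
    refine ContinuousAt.comp (g := Complex.arg) ?_ hw.continuousAt
    rw [hwp]
    exact Complex.continuousAt_arg (by simp [Complex.slitPlane, hr])
  · simp [hwp, Complex.arg_ofReal_of_nonneg hr.le, abs_of_pos hr]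
  · intro u
    have h1 : (‖w u‖ : ℂ) * Complex.exp (((θ + Complex.arg (w u) : ℝ) : ℂ) * Complex.I) =
        (u 0 : ℂ) + (u 1 : ℂ) * Complex.I := by
      have := Complex.norm_mul_exp_arg_mul_I (w u)
      push_cast
      rw [add_mul, Complex.exp_add, mul_left_comm, this]
      simp only [w]
      rw [mul_left_comm, ← Complex.exp_add]
      simp
    rw [Complex.exp_mul_I, ← Complex.ofReal_cos, ← Complex.ofReal_sin] at h1
    have hre := congrArg Complex.re h1
    have him := congrArg Complex.im h1
    simp only [Complex.mul_re, Complex.mul_im, Complex.add_re, Complex.add_im, Complex.ofReal_re,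
      Complex.ofReal_im, Complex.I_re, Complex.I_im] at hre him
    ext i
    fin_cases i
    · simp [polar]; linarith
    · simp [polar]; linarith

/-! ### Flat coordinates at regular points -/

section Flat

variable {S : Type*} [MetricSpace S] [ChartedSpace Plane S]

variable (S) in
-- A compact neighbourhood in `S` stays closed in the completion, so by density it contains a whole
-- ball of the completion.
theorem isOpen_range_coe : IsOpen (Set.range ((↑) : S → Completion S)) := by
  have : LocallyCompactSpace S := ChartedSpace.locallyCompactSpace Plane S
  rw [isOpen_iff_mem_nhds]
  rintro _ ⟨x, rfl⟩
  obtain ⟨K, hK, hxK⟩ := exists_compact_mem_nhds x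
  obtain ⟨r, hr, hrK⟩ := Metric.mem_nhds_iff.1 hxK
  have hKc : IsClosed (((↑) : S → Completion S) '' K) :=
    (hK.image (Completion.continuous_coe S)).isClosed
  refine mem_of_superset (Metric.ball_mem_nhds (x : Completion S) hr) ?_
  calc Metric.ball (x : Completion S) r
      ⊆ closure (Metric.ball (x : Completion S) r ∩ Set.range ((↑) : S → Completion S)) :=
        Completion.denseRange_coe.open_subset_closure_inter Metric.isOpen_ball
    _ ⊆ ((↑) : S → Completion S) '' K := by
        refine closure_minimal ?_ hKc
        rintro _ ⟨hq, ⟨y, rfl⟩⟩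
        refine ⟨y, hrK ?_, rfl⟩
        rwa [Metric.mem_ball, Completion.dist_eq] at hq
    _ ⊆ _ := Set.image_subset_range _ _

variable (S) in
theorem isOpenEmbedding_coe : IsOpenEmbedding ((↑) : S → Completion S) :=
  ⟨(Completion.isUniformEmbedding_coe S).isEmbedding, isOpen_range_coe S⟩

theorem nhds_coe (x : S) : 𝓝 (x : Completion S) = map (↑) (𝓝 x) :=
  ((isOpenEmbedding_coe S).map_nhds_eq x).symm

theorem eventually_nhds_coe {x : S} {P : Completion S → Prop} :
    (∀ᶠ p in 𝓝 (x : Completion S), P p) ↔ ∀ᶠ y : S in 𝓝 x, P (y : Completion S) := by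
  rw [nhds_coe, eventually_map]

omit [ChartedSpace Plane S] in
theorem notMem_singularSet {p : Completion S} :
    p ∉ singularSet S ↔ ∃ x : S, (x : Completion S) = p := by
  simp [singularSet]

omit [ChartedSpace Plane S] in
theorem coe_notMem_singularSet (x : S) : (x : Completion S) ∉ singularSet S :=
  notMem_singularSet.2 ⟨x, rfl⟩

/-- The chart at `x` as a map on the completion. -/
def liftChart (x : S) : Completion S → Plane :=
  Function.extend (↑) (chartAt Plane x) 0

@[simp]
theorem liftChart_coe (x y : S) : liftChart x (y : Completion S) = chartAt Plane x y :=
  (Completion.coe_injective S).extend_apply _ _ _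

/-- The domain of the chart at `x` as a subset of the completion. -/
def chartDomain (x : S) : Set (Completion S) := (↑) '' (chartAt Plane x).source

theorem isOpen_chartDomain (x : S) : IsOpen (chartDomain x) :=
  (isOpenEmbedding_coe S).isOpenMap _ (chartAt Plane x).open_source

theorem mem_chartDomain (x : S) : (x : Completion S) ∈ chartDomain x :=
  ⟨x, mem_chart_source Plane x, rfl⟩

theorem continuousOn_liftChart (x : S) : ContinuousOn (liftChart x) (chartDomain x) := by
  rintro _ ⟨y, hy, rfl⟩
  refine ContinuousAt.continuousWithinAt ?_
  rw [ContinuousAt, nhds_coe, tendsto_map'_iff, liftChart_coe]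
  refine ((chartAt Plane x).continuousAt hy).tendsto.congr ?_
  exact fun z => (liftChart_coe x z).symm

/-- A condition that recurs in the definitions, in terms of `liftChart`. -/
theorem exists_mem_source_iff {x : S} {p : Completion S} {u : Plane} :
    (∃ y ∈ (chartAt Plane x).source, p = (y : Completion S) ∧ chartAt Plane x y = u) ↔
      p ∈ chartDomain x ∧ liftChart x p = u := by
  constructor
  · rintro ⟨y, hy, rfl, h⟩
    exact ⟨⟨y, hy, rfl⟩, by rw [liftChart_coe, h]⟩
  · rintro ⟨⟨y, hy, rfl⟩, h⟩
    exact ⟨y, hy, rfl, by rw [← h, liftChart_coe]⟩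

theorem chartAt_eventually_eq_add [TranslationSurface S] {x x' y : S}
    (hy : y ∈ (chartAt Plane x).source) (hy' : y ∈ (chartAt Plane x').source) :
    ∃ v : Plane, ∀ᶠ q in 𝓝 y, chartAt Plane x' q = chartAt Plane x q + v := by
  have h := HasGroupoid.compatible (G := translationGroupoid) (chart_mem_atlas Plane x)
    (chart_mem_atlas Plane x')
  have h1 := (mem_groupoid_of_pregroupoid.1 h).1
  have hmem : chartAt Plane x y ∈ ((chartAt Plane x).symm.trans (chartAt Plane x')).source := by
    simp [hy, hy']
  obtain ⟨v, hv⟩ := h1 _ hmem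
  rw [((chartAt Plane x).symm.trans (chartAt Plane x')).open_source.nhdsWithin_eq hmem] at hv
  refine ⟨v, ?_⟩
  filter_upwards [((chartAt Plane x).continuousAt hy).eventually hv,
    (chartAt Plane x).open_source.mem_nhds hy] with q hq hqs
  simpa [(chartAt Plane x).left_inv hqs] using hq

theorem liftChart_eventually_eq_add [TranslationSurface S] {x x' : S} {p : Completion S}
    (hp : p ∈ chartDomain x) (hp' : p ∈ chartDomain x') :
    ∃ v : Plane, ∀ᶠ q in 𝓝 p, liftChart x' q = liftChart x q + v := by
  obtain ⟨y, hy, rfl⟩ := hp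
  obtain ⟨y', hy', h⟩ := hp'
  rw [(Completion.coe_injective S) h] at hy'
  obtain ⟨v, hv⟩ := chartAt_eventually_eq_add hy hy'
  refine ⟨v, eventually_nhds_coe.2 ?_⟩
  simpa using hv

theorem isFlatCoordinate_liftChart [TranslationSurface S] (x : S) :
    IsFlatCoordinate (liftChart x) (chartDomain x) := by
  refine ⟨continuousOn_liftChart x, fun y hy => ?_⟩
  obtain ⟨v, hv⟩ := liftChart_eventually_eq_add (mem_chartDomain y) hy
  refine ⟨v, ?_⟩
  simpa using eventually_nhds_coe.1 hv

theorem IsFlatCoordinate.add_const {D : Completion S → Plane} {U : Set (Completion S)}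
    (hD : IsFlatCoordinate D U) (v : Plane) : IsFlatCoordinate (fun p => D p + v) U := by
  refine ⟨hD.1.add continuousOn_const, fun x hx => ?_⟩
  obtain ⟨w, hw⟩ := hD.2 x hx
  refine ⟨w + v, ?_⟩
  filter_upwards [hw] with y hy
  rw [hy, add_assoc]

theorem IsFlatCoordinate.eventually_eq_liftChart {D : Completion S → Plane}
    {U : Set (Completion S)} (hD : IsFlatCoordinate D U) {x : S} (hx : (x : Completion S) ∈ U) :
    ∃ v : Plane, ∀ᶠ p in 𝓝 (x : Completion S), D p = liftChart x p + v := by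
  obtain ⟨v, hv⟩ := hD.2 x hx
  refine ⟨v, eventually_nhds_coe.2 ?_⟩
  simpa using hv

theorem IsFlatCoordinate.eventually_sub_eq_of_coe {D D' : Completion S → Plane}
    {U U' : Set (Completion S)} (hD : IsFlatCoordinate D U) (hD' : IsFlatCoordinate D' U')
    {x : S} (hx : (x : Completion S) ∈ U) (hx' : (x : Completion S) ∈ U') :
    ∀ᶠ q in 𝓝 (x : Completion S), D' q - D q = D' x - D x := by
  obtain ⟨v, hv⟩ := hD.eventually_eq_liftChart hx
  obtain ⟨v', hv'⟩ := hD'.eventually_eq_liftChart hx'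
  have h := hv.self_of_nhds
  have h' := hv'.self_of_nhds
  filter_upwards [hv, hv'] with q hq hq'
  rw [hq, hq', h, h']
  abel

/-! ### Flat coordinates at cone points -/

/-- The coordinate is `polar r θ`, with `p` sent to the origin. It is continuous at `p` because its
norm is the distance from `p`. Smaller punctured balls are images of the strips `(0, ε') × ℝ` and
hence connected, also when the angle is infinite. -/
theorem IsConePoint.exists_isFlatCoordinate [TranslationSurface S] {p : Completion S} {n : ℕ}
    (hp : IsConePoint p n) (hpS : p ∈ singularSet S) :
    ∃ ε > 0, ∃ D : Completion S → Plane, IsFlatCoordinate D (Metric.ball p ε) ∧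
      ∀ ε' ≤ ε, IsPreconnected (Metric.ball p ε' \ {p}) ∧
        Metric.ball p ε' \ {p} ⊆ Set.range ((↑) : S → Completion S) := by
  obtain ⟨ε, hε, c, hdist, hball, hinj, hflat⟩ := hp
  have hcne : ∀ r θ, (c r θ : Completion S) ≠ p := fun r θ h => hpS ⟨_, h⟩
  have hccont : ∀ r ∈ Set.Ioo 0 ε, ∀ θ, ContinuousAt (fun q : ℝ × ℝ => c q.1 q.2) (r, θ) := by
    intro r hr θ
    obtain ⟨v, hv⟩ := hflat r hr θ
    have hev : (fun q : ℝ × ℝ => c q.1 q.2) =ᶠ[𝓝 (r, θ)]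
        fun q => (chartAt Plane (c r θ)).symm (polar q.1 q.2 + v) := by
      filter_upwards [hv] with q hq
      rw [← hq.2, (chartAt Plane (c r θ)).left_inv hq.1]
    refine ContinuousAt.congr ?_ hev.symm
    have h0 := hv.self_of_nhds
    refine ContinuousAt.comp (g := (chartAt Plane (c r θ)).symm) ?_
      (continuous_polar.add continuous_const).continuousAt
    refine (chartAt Plane (c r θ)).continuousAt_symm ?_
    rw [← h0.2]
    exact (chartAt Plane (c r θ)).map_source h0.1
  -- the coordinate
  have hex : ∀ q ∈ Metric.ball p ε \ {p},
      ∃ r ∈ Set.Ioo 0 ε, ∃ θ : ℝ, (c r θ : Completion S) = q := by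
    intro q hq
    have := hq.1
    rw [hball] at this
    exact this.resolve_left hq.2
  choose! R hR Θ hΘ using hex
  classical
  let D : Completion S → Plane := fun q => if q = p then 0 else polar (R q) (Θ q)
  have hDp : D p = 0 := if_pos rfl
  have hmem : ∀ r ∈ Set.Ioo 0 ε, ∀ θ, (c r θ : Completion S) ∈ Metric.ball p ε \ {p} := by
    intro r hr θ
    refine ⟨?_, hcne r θ⟩
    rw [Metric.mem_ball, hdist r hr]
    exact hr.2
  have hDc : ∀ r ∈ Set.Ioo 0 ε, ∀ θ, D (c r θ : Completion S) = polar r θ := by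
    intro r hr θ
    have h1 := hΘ _ (hmem r hr θ)
    have h2 := (Completion.coe_injective S) h1
    obtain ⟨hr', m, hm⟩ := (hinj _ (hR _ (hmem r hr θ)) _ hr _ _).1 h2
    simp only [D, if_neg (hcne r θ)]
    rw [hr']
    -- Angles of the same point differ by a multiple of `2πn`, in particular of `2π`; for `n = 0`
    -- they agree.
    refine polar_eq_of_sub (m := m * n) ?_
    rw [hm]; push_cast; ring
  have hnorm : ∀ q ∈ Metric.ball p ε, ‖D q‖ = dist q p := by
    intro q hq
    by_cases hqp : q = p
    · rw [hqp, hDp, norm_zero, dist_self]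
    · have h1 := hR q ⟨hq, hqp⟩
      rw [← hΘ q ⟨hq, hqp⟩, hDc _ h1, norm_polar h1.1.le, hdist _ h1]
  have hreg : ∀ x : S, (x : Completion S) ∈ Metric.ball p ε →
      ∃ v : Plane, ∀ᶠ y : S in 𝓝 x, D (y : Completion S) = chartAt Plane x y + v := by
    intro x hx
    have hxp : (x : Completion S) ∈ Metric.ball p ε \ {p} := ⟨hx, fun h => hpS ⟨x, h⟩⟩
    have hr := hR _ hxp
    have hc := (Completion.coe_injective S) (hΘ _ hxp)
    set r := R (x : Completion S)
    set θ := Θ (x : Completion S)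
    obtain ⟨v, hv⟩ := hflat r hr θ
    rw [hc] at hv
    obtain ⟨g, hg, hg0, hgs⟩ := exists_polar_section hr.1 θ
    have h0 := hv.self_of_nhds
    simp only [hc] at h0
    have hval : chartAt Plane x x - v = polar r θ := by rw [h0.2]; abel
    have hcont : ContinuousAt (fun y : S => g (chartAt Plane x y - v)) x := by
      refine ContinuousAt.comp (g := g) (f := fun y : S => chartAt Plane x y - v) ?_ ?_
      · rw [hval]; exact hg
      · exact ((chartAt Plane x).continuousAt (mem_chart_source Plane x)).sub continuousAt_const
    have hIoo : ∀ᶠ q : ℝ × ℝ in 𝓝 (r, θ), q.1 ∈ Set.Ioo 0 ε :=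
      continuous_fst.continuousAt.eventually (isOpen_Ioo.mem_nhds hr)
    have hev := hcont.eventually (p := fun q => (c q.1 q.2 ∈ (chartAt Plane x).source ∧
      chartAt Plane x (c q.1 q.2) = polar q.1 q.2 + v) ∧ q.1 ∈ Set.Ioo 0 ε)
      (by simp only [hval, hg0]; exact hv.and hIoo)
    refine ⟨-v, ?_⟩
    filter_upwards [hev, (chartAt Plane x).open_source.mem_nhds (mem_chart_source Plane x)]
      with y hy hys
    -- The point with polar coordinates `g (chartAt Plane x y - v)` has the same chart value as `y`,
    -- so it is `y`.
    have h1 : chartAt Plane x (c (g (chartAt Plane x y - v)).1 (g (chartAt Plane x y - v)).2) =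
        chartAt Plane x y := by
      rw [hy.1.2, hgs]; abel
    have h2 := (chartAt Plane x).injOn hy.1.1 hys h1
    have h3 := hDc _ hy.2 (g (chartAt Plane x y - v)).2
    rw [h2] at h3
    rw [h3, hgs, sub_eq_add_neg]
  refine ⟨ε, hε, D, ⟨?_, hreg⟩, ?_⟩
  · intro q hq
    refine ContinuousAt.continuousWithinAt ?_
    by_cases hqp : q = p
    · rw [hqp, ContinuousAt, hDp, tendsto_zero_iff_norm_tendsto_zero]
      have h1 : Tendsto (fun q => dist q p) (𝓝 p) (𝓝 0) := by
        have := (continuous_id.dist (continuous_const (y := p))).tendsto p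
        simpa using this
      refine h1.congr' ?_
      filter_upwards [Metric.ball_mem_nhds p hε] with z hz using (hnorm z hz).symm
    · have hex' : ∃ x : S, (x : Completion S) = q := ⟨_, hΘ q ⟨hq, hqp⟩⟩
      obtain ⟨x, rfl⟩ := hex'
      obtain ⟨v, hv⟩ := hreg x hq
      rw [ContinuousAt, nhds_coe, tendsto_map'_iff, hv.self_of_nhds]
      have h1 : ContinuousAt (fun y : S => chartAt Plane x y + v) x :=
        ((chartAt Plane x).continuousAt (mem_chart_source Plane x)).add continuousAt_const
      refine h1.tendsto.congr' ?_
      filter_upwards [hv] with y hy using hy.symm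
  · intro ε' hε'
    have himg : Metric.ball p ε' \ {p} =
        (fun q : ℝ × ℝ => (c q.1 q.2 : Completion S)) '' (Set.Ioo 0 ε' ×ˢ Set.univ) := by
      ext q
      constructor
      · rintro ⟨hq, hqp⟩
        have hqε : q ∈ Metric.ball p ε \ {p} := ⟨Metric.ball_subset_ball hε' hq, hqp⟩
        refine ⟨(R q, Θ q), ⟨⟨(hR q hqε).1, ?_⟩, trivial⟩, hΘ q hqε⟩
        rw [← hdist _ (hR q hqε) (Θ q), hΘ q hqε]
        exact hq
      · rintro ⟨⟨r, θ⟩, ⟨hr, -⟩, rfl⟩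
        refine ⟨?_, hcne r θ⟩
        rw [Metric.mem_ball, hdist r ⟨hr.1, hr.2.trans_le hε'⟩]
        exact hr.2
    rw [himg]
    refine ⟨?_, ?_⟩
    · refine (isPreconnected_Ioo.prod isPreconnected_univ).image _ ?_
      rintro ⟨r, θ⟩ ⟨hr, -⟩
      exact ((Completion.continuous_coe S).continuousAt.comp
        (hccont r ⟨hr.1, hr.2.trans_le hε'⟩ θ)).continuousWithinAt
    · rintro _ ⟨q, -, rfl⟩
      exact ⟨_, rfl⟩

end Flat

/-! ### Developments and holonomy -/

section Development

variable {S : Type*} [MetricSpace S] [ChartedSpace Plane S] [TranslationSurface S]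

/-- Two flat coordinates differ by a constant near every point, also near a singularity. -/
theorem IsFlatCoordinate.eventually_sub_eq (hS : IsTame S) {D D' : Completion S → Plane}
    {U U' : Set (Completion S)} (hD : IsFlatCoordinate D U) (hD' : IsFlatCoordinate D' U')
    {p : Completion S} (hU : U ∈ 𝓝 p) (hU' : U' ∈ 𝓝 p) :
    ∀ᶠ q in 𝓝 p, D' q - D q = D' p - D p := by
  by_cases hp : p ∈ singularSet S
  swap
  · obtain ⟨x, rfl⟩ := notMem_singularSet.1 hp
    exact hD.eventually_sub_eq_of_coe hD' (mem_of_mem_nhds hU) (mem_of_mem_nhds hU')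
  obtain ⟨n, hn⟩ := hS p hp
  obtain ⟨ε, hε, -, -, hpunct⟩ := hn.exists_isFlatCoordinate hp
  obtain ⟨ε₁, hε₁, hball⟩ := Metric.mem_nhds_iff.1 (inter_mem hU hU')
  set ε' := min ε ε₁
  have hε' : 0 < ε' := lt_min hε hε₁
  obtain ⟨hconn, hrange⟩ := hpunct ε' (min_le_left _ _)
  have hsub : Metric.ball p ε' ⊆ U ∩ U' :=
    (Metric.ball_subset_ball (min_le_right _ _)).trans hball
  filter_upwards [Metric.ball_mem_nhds p hε'] with q hq
  -- The difference is locally constant at the regular points of the punctured ball, which is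
  -- connected and dense in the ball.
  refine eq_of_eventually_of_subset_closure (f := fun q => D' q - D q) hconn ?_ ?_
    Set.sdiff_subset ?_ hq (Metric.mem_ball_self hε')
  · intro z hz
    obtain ⟨x, rfl⟩ := hrange hz
    have := hsub hz.1
    exact (hD.eventually_sub_eq_of_coe hD' this.1 this.2).filter_mono nhdsWithin_le_nhds
  · exact (hD'.1.mono fun z hz => (hsub hz).2).sub (hD.1.mono fun z hz => (hsub hz).1)
  · refine (Completion.denseRange_coe.open_subset_closure_inter Metric.isOpen_ball).trans
      (closure_mono ?_)
    rintro z ⟨hz, ⟨x, rfl⟩⟩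
    exact ⟨hz, fun h => hp ⟨x, h⟩⟩

/-- Every point of the completion of a tame surface has a neighbourhood with a flat coordinate. -/
theorem IsTame.exists_isFlatCoordinate (hS : IsTame S) (p : Completion S) :
    ∃ (U : Set (Completion S)) (D : Completion S → Plane),
      IsOpen U ∧ p ∈ U ∧ IsFlatCoordinate D U := by
  by_cases hp : p ∈ singularSet S
  · obtain ⟨n, hn⟩ := hS p hp
    obtain ⟨ε, hε, D, hD, -⟩ := hn.exists_isFlatCoordinate hp
    exact ⟨_, D, Metric.isOpen_ball, Metric.mem_ball_self hε, hD⟩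
  · obtain ⟨x, rfl⟩ := notMem_singularSet.1 hp
    exact ⟨_, _, isOpen_chartDomain x, mem_chartDomain x, isFlatCoordinate_liftChart x⟩

/-- The difference of two developments is locally constant on `I`. Hence the choice made in
`holonomy` is harmless. -/
theorem IsExtendedDevelopment.sub_eq_sub (hS : IsTame S) {γ : C(I, Completion S)}
    {δ δ' : C(I, Plane)} (hδ : IsExtendedDevelopment γ δ) (hδ' : IsExtendedDevelopment γ δ') :
    δ 1 - δ 0 = δ' 1 - δ' 0 := by
  have h : (fun t => δ' t - δ t) 0 = (fun t => δ' t - δ t) 1 := by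
    refine eq_of_eventually_of_isPreconnected (A := (Set.univ : Set I)) (f := fun t => δ' t - δ t)
      isPreconnected_univ ?_ trivial trivial
    intro t _
    rw [nhdsWithin_univ]
    obtain ⟨U, D, hU, hγU, hD, hev⟩ := hδ t
    obtain ⟨U', D', hU', hγU', hD', hev'⟩ := hδ' t
    have h1 := hD.eventually_sub_eq hS hD' (hU.mem_nhds hγU) (hU'.mem_nhds hγU')
    filter_upwards [hev, hev', (γ.continuous.tendsto t).eventually h1] with s h2 h3 h4
    rw [h2, h3, h4, hev.self_of_nhds, hev'.self_of_nhds]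
  simp only at h
  rw [sub_eq_sub_iff_add_eq_add] at h ⊢
  rw [add_comm, ← h, add_comm]

theorem IsExtendedDevelopment.holonomy_eq (hS : IsTame S) {γ : C(I, Completion S)}
    {δ : C(I, Plane)} (hδ : IsExtendedDevelopment γ δ) : holonomy γ = δ 1 - δ 0 := by
  have h : ∃ v : Plane, ∃ δ : C(I, Plane), IsExtendedDevelopment γ δ ∧ v = δ 1 - δ 0 :=
    ⟨_, δ, hδ, rfl⟩
  rw [holonomy, dif_pos h]
  obtain ⟨δ', hδ', h'⟩ := h.choose_spec
  rw [h', hδ'.sub_eq_sub hS hδ]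

/-- On a tame surface, every path has a development. -/
theorem IsTame.exists_isExtendedDevelopment (hS : IsTame S) (γ : C(I, Completion S)) :
    ∃ δ : C(I, Plane), IsExtendedDevelopment γ δ := by
  choose U D hU hmem hD using hS.exists_isFlatCoordinate
  obtain ⟨t, ht0, hmono, ⟨n, hn⟩, hcov⟩ := exists_monotone_Icc_subset_open_cover_unitInterval
    (c := fun s : I => γ ⁻¹' U (γ s)) (fun s => (hU _).preimage γ.continuous)
    (fun s _ => Set.mem_iUnion.2 ⟨s, hmem _⟩)
  -- Analytic continuation along a subdivision. The one-sided filter at `t m` leaves room for an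
  -- extension beyond `t m`.
  have key : ∀ m : ℕ, ∃ δ : I → Plane, ∀ s ≤ t m, ∃ (V : Set (Completion S))
      (E : Completion S → Plane), IsOpen V ∧ γ s ∈ V ∧ IsFlatCoordinate E V ∧
        ∀ᶠ r in 𝓝[Set.Iic (t m)] s, δ r = E (γ r) := by
    intro m
    induction m with
    | zero =>
      refine ⟨fun s => D (γ 0) (γ s), fun s hs => ⟨U (γ 0), D (γ 0), hU _, ?_, hD _,
        Eventually.of_forall fun r => rfl⟩⟩
      rw [ht0] at hs
      rw [le_antisymm hs s.2.1]
      exact hmem _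
    | succ m ih =>
      obtain ⟨δ, hδ⟩ := ih
      obtain ⟨a, ha⟩ := hcov m
      obtain ⟨V, E, hV, hγV, hE, hev⟩ := hδ (t m) le_rfl
      have htm : γ (t m) ∈ U (γ a) := ha ⟨le_rfl, hmono m.le_succ⟩
      -- The shift that makes the next coordinate continue the development already built.
      set w := E (γ (t m)) - D (γ a) (γ (t m))
      have hsub : ∀ᶠ r in 𝓝 (t m), E (γ r) - D (γ a) (γ r) = w :=
        (γ.continuous.tendsto _).eventually
          ((hD _).eventually_sub_eq hS hE ((hU _).mem_nhds htm) (hV.mem_nhds hγV))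
      refine ⟨fun s => if s ≤ t m then δ s else D (γ a) (γ s) + w, fun s hs => ?_⟩
      rcases lt_trichotomy s (t m) with hlt | rfl | hgt
      · obtain ⟨V', E', hV', hγV', hE', hev'⟩ := hδ s hlt.le
        refine ⟨V', E', hV', hγV', hE', eventually_nhdsWithin_of_eventually_nhds ?_⟩
        rw [nhdsWithin_eq_nhds.2 (Iic_mem_nhds hlt)] at hev'
        filter_upwards [hev', Iic_mem_nhds hlt] with r hr hr'
        rw [if_pos (Set.mem_Iic.1 hr'), hr]
      · refine ⟨V, E, hV, hγV, hE, eventually_nhdsWithin_of_eventually_nhds ?_⟩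
        filter_upwards [eventually_nhdsWithin_iff.1 hev, hsub] with r hr hr'
        split_ifs with h
        · exact hr h
        · rw [← hr']; abel
      · refine ⟨U (γ a), fun p => D (γ a) p + w, hU _, ha ⟨hgt.le, hs⟩, (hD _).add_const w,
          eventually_nhdsWithin_of_eventually_nhds ?_⟩
        filter_upwards [lt_mem_nhds hgt] with r hr
        rw [if_neg hr.not_ge]
  obtain ⟨δ, hδ⟩ := key n
  rw [hn n le_rfl] at hδ
  have hδ' : ∀ s, ∃ (V : Set (Completion S)) (E : Completion S → Plane),
      IsOpen V ∧ γ s ∈ V ∧ IsFlatCoordinate E V ∧ ∀ᶠ r in 𝓝 s, δ r = E (γ r) := by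
    intro s
    obtain ⟨V, E, hV, hγV, hE, hev⟩ := hδ s s.2.2
    refine ⟨V, E, hV, hγV, hE, ?_⟩
    rwa [nhdsWithin_eq_nhds.2 (mem_of_superset univ_mem fun r _ => r.2.2)] at hev
  refine ⟨⟨δ, continuous_iff_continuousAt.2 fun s => ?_⟩, hδ'⟩
  obtain ⟨V, E, hV, hγV, hE, hev⟩ := hδ' s
  refine ContinuousAt.congr ?_ (hev.mono fun r hr => hr.symm)
  exact ContinuousAt.comp (g := E) (hE.1.continuousAt (hV.mem_nhds hγV)) γ.continuous.continuousAt

/-- The conditions on a saddle connection are those of a development at the interior times; by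
continuity they extend to the initial time. -/
theorem exists_isFlatCoordinate_eventually_smul_eq (hS : IsTame S) {γ : C(I, Completion S)}
    {v : Plane} (h : ∀ t : I, t ≠ 0 → t ≠ 1 → ∃ x : S, γ t = (x : Completion S) ∧
      ∃ w : Plane, ∀ᶠ s : I in 𝓝 t, ∃ y ∈ (chartAt Plane x).source,
        γ s = (y : Completion S) ∧ chartAt Plane x y = (s : ℝ) • v + w) :
    ∃ (U : Set (Completion S)) (D : Completion S → Plane),
      IsOpen U ∧ γ 0 ∈ U ∧ IsFlatCoordinate D U ∧ ∀ᶠ s : I in 𝓝 0, (s : ℝ) • v = D (γ s) := by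
  obtain ⟨U, D, hU, hγU, hD⟩ := hS.exists_isFlatCoordinate (γ 0)
  have hUγ : γ ⁻¹' U ∈ 𝓝 (0 : I) := (hU.preimage γ.continuous).mem_nhds hγU
  obtain ⟨a, ha, haU⟩ : ∃ a : I, 0 < a ∧ Set.Ico 0 a ⊆ γ ⁻¹' U := by
    obtain ⟨a, ha, haU⟩ := exists_Ico_subset_of_mem_nhds hUγ ⟨1, zero_lt_one⟩
    exact ⟨a, ha, haU⟩
  refine ⟨U, fun p => D p + -D (γ 0), hU, hγU, hD.add_const _, ?_⟩
  have hnhds : Set.Ico 0 a ∈ 𝓝 (0 : I) := by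
    filter_upwards [gt_mem_nhds ha] with s hs using ⟨s.2.1, hs⟩
  filter_upwards [hnhds] with s hs
  have hcont : ContinuousOn (fun s : I => D (γ s) - (s : ℝ) • v) (Set.Ico 0 a) :=
    (hD.1.comp γ.continuous.continuousOn haU).sub (by fun_prop)
  have := eq_of_eventually_of_subset_closure (f := fun s : I => D (γ s) - (s : ℝ) • v)
    (isPreconnected_Ioo (a := (0 : I)) (b := a)) ?_ hcont Set.Ioo_subset_Ico_self
    (by rw [closure_Ioo ha.ne]; exact Set.Ico_subset_Icc_self) hs ⟨le_rfl, ha⟩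
  · simp only [Set.Icc.coe_zero, zero_smul, sub_zero] at this
    rw [← this]; abel
  · intro t ht
    refine eventually_nhdsWithin_of_eventually_nhds ?_
    obtain ⟨x, hx, w, hw⟩ := h t ht.1.ne' (ht.2.trans_le a.2.2).ne
    simp only [exists_mem_source_iff] at hw
    have hγx : (x : Completion S) ∈ U := hx ▸ haU ⟨ht.1.le, ht.2⟩
    obtain ⟨u, hu⟩ := hD.eventually_eq_liftChart hγx
    rw [← hx] at hu
    have hu' := (γ.continuous.tendsto t).eventually hu
    filter_upwards [hw, hu'] with s h1 h2
    rw [h2, h1.2, hu'.self_of_nhds, hw.self_of_nhds.2]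
    abel

/-- The development of a saddle connection is a development in the completion. -/
theorem IsHolonomyVector.exists_holonomy_eq (hS : IsTame S) {v : Plane}
    (hv : IsHolonomyVector S v) :
    ∃ γ : C(I, Completion S), γ 0 ∈ singularSet S ∧ γ 1 ∈ singularSet S ∧ holonomy γ = v := by
  obtain ⟨-, γ, h0, h1, h⟩ := hv
  refine ⟨γ, h0, h1, ?_⟩
  let δ : C(I, Plane) := ⟨fun s => (s : ℝ) • v, by fun_prop⟩
  have hδ : IsExtendedDevelopment γ δ := by
    intro t
    by_cases ht0 : t = 0
    · rw [ht0]
      exact exists_isFlatCoordinate_eventually_smul_eq hS h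
    by_cases ht1 : t = 1
    · rw [ht1]
      -- The end of the path is treated as the beginning of the reversed path, with vector `-v`.
      let γ' : C(I, Completion S) := γ.comp ⟨unitInterval.symm, unitInterval.continuous_symm⟩
      obtain ⟨U, D, hU, hγU, hD, hev⟩ :=
        exists_isFlatCoordinate_eventually_smul_eq hS (γ := γ') (v := -v) (by
          intro s hs0 hs1
          obtain ⟨x, hx, w, hw⟩ := h (unitInterval.symm s) (by simpa using hs1)
            (by simpa using hs0)
          refine ⟨x, hx, w + v, ?_⟩
          filter_upwards [(unitInterval.continuous_symm.tendsto s).eventually hw] with r hr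
          obtain ⟨y, hy, hy1, hy2⟩ := hr
          refine ⟨y, hy, hy1, ?_⟩
          rw [hy2, unitInterval.coe_symm_eq, sub_smul, one_smul, smul_neg]
          abel)
      refine ⟨U, fun p => D p + v, hU, by simpa [γ'] using hγU, hD.add_const v, ?_⟩
      have hσ : Tendsto unitInterval.symm (𝓝 1) (𝓝 0) := by
        simpa using unitInterval.continuous_symm.tendsto 1
      filter_upwards [hσ.eventually hev] with s hs
      simp only [γ', ContinuousMap.comp_apply, ContinuousMap.coe_mk, unitInterval.symm_symm,
        unitInterval.coe_symm_eq] at hs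
      simp only [δ, ContinuousMap.coe_mk]
      rw [← hs, sub_smul, one_smul, smul_neg]
      abel
    · obtain ⟨x, hx, w, hw⟩ := h t ht0 ht1
      simp only [exists_mem_source_iff] at hw
      refine ⟨_, _, isOpen_chartDomain x, hx ▸ mem_chartDomain x,
        (isFlatCoordinate_liftChart x).add_const (-w), ?_⟩
      filter_upwards [hw] with s hs
      rw [hs.2]
      simp [δ]
  rw [hδ.holonomy_eq hS]
  simp [δ]

theorem IsHolonomyVector.mem_relativeHolonomy (hS : IsTame S) {v : Plane}
    (hv : IsHolonomyVector S v) : v ∈ relativeHolonomy S := by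
  obtain ⟨γ, h0, h1, rfl⟩ := hv.exists_holonomy_eq hS
  refine ⟨Finsupp.single γ 1, ?_, by simp [chainHolonomy]⟩
  change boundary _ _ ∈ Finsupp.supported ℤ ℤ (singularSet S)
  simp only [boundary, Finsupp.liftAddHom_apply_single, AddMonoidHom.sub_apply,
    Finsupp.singleAddHom_apply]
  exact Submodule.sub_mem _ (Finsupp.single_mem_supported ℤ 1 h1)
    (Finsupp.single_mem_supported ℤ 1 h0)

end Development

/-! ### Triangles in the plane -/

section Triangle

variable {p : Fin 3 → Plane}

theorem exists_affineBasis (hp : AffineIndependent ℝ p) :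
    ∃ b : AffineBasis (Fin 3) ℝ Plane, ⇑b = p :=
  ⟨⟨p, hp, (hp.affineSpan_eq_top_iff_card_eq_finrank_add_one).2 (by simp)⟩, rfl⟩

theorem mem_triangle_cases (hp : AffineIndependent ℝ p) {z : Plane}
    (hz : z ∈ convexHull ℝ (Set.range p)) :
    z ∈ interior (convexHull ℝ (Set.range p)) ∨ z ∈ Set.range p ∨
      ∃ j, z ∈ openSegment ℝ (p (j + 1)) (p (j + 2)) := by
  obtain ⟨b, rfl⟩ := exists_affineBasis hp
  rw [b.interior_convexHull]
  rw [b.convexHull_eq_nonneg_coord] at hz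
  by_cases h : ∀ i, 0 < b.coord i z
  · exact Or.inl h
  right
  push Not at h
  obtain ⟨j, hj⟩ := h
  have hj0 : b.coord j z = 0 := le_antisymm hj (hz j)
  have hsum := b.sum_coord_apply_eq_one z
  have hself := b.linear_combination_coord_eq_self z
  -- The sum is started at `j`, so that one argument serves all three edges.
  have h3 : ∀ {M : Type} [AddCommMonoid M] (f : Fin 3 → M),
      ∑ i, f i = f j + f (j + 1) + f (j + 2) := by
    intro M _ f
    rw [Fin.sum_univ_three]
    fin_cases j
    · rfl
    · change _ = f 1 + f 2 + f 0
      abel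
    · change _ = f 2 + f 0 + f 1
      abel
  rw [h3, hj0, zero_add] at hsum
  rw [h3, hj0, zero_smul, zero_add] at hself
  rcases (hz (j + 1)).eq_or_lt with h1 | h1
  · left
    rw [← h1, zero_add] at hsum
    rw [← h1, zero_smul, zero_add, hsum, one_smul] at hself
    exact ⟨_, hself⟩
  rcases (hz (j + 2)).eq_or_lt with h2 | h2
  · left
    rw [← h2, add_zero] at hsum
    rw [← h2, zero_smul, add_zero, hsum, one_smul] at hself
    exact ⟨_, hself⟩
  · exact Or.inr ⟨j, _, _, h1, h2, hsum, hself⟩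

theorem coord_openSegment (b : AffineBasis (Fin 3) ℝ Plane) {i j : Fin 3} {z : Plane}
    (hz : z ∈ openSegment ℝ (b i) (b j)) (hij : i ≠ j) :
    (0 < b.coord i z ∧ b.coord i z < 1) ∧ ∀ l, l ≠ i → l ≠ j → b.coord l z = 0 := by
  obtain ⟨s, t, hs, ht, hst, rfl⟩ := hz
  have h : ∀ l, b.coord l (s • b i + t • b j) = s * b.coord l (b i) + t * b.coord l (b j) := by
    intro l
    have := Convex.combo_affine_apply (f := b.coord l) (x := b i) (y := b j) hst
    simpa using this
  refine ⟨?_, fun l hi hj => ?_⟩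
  · rw [h, b.coord_apply_eq, b.coord_apply_ne hij]
    constructor <;> linarith
  · rw [h, b.coord_apply_ne hi, b.coord_apply_ne hj]
    simp

theorem openSegment_notMem_range (hp : AffineIndependent ℝ p) {i j : Fin 3} (hij : i ≠ j)
    {z : Plane} (hz : z ∈ openSegment ℝ (p i) (p j)) : z ∉ Set.range p := by
  obtain ⟨b, rfl⟩ := exists_affineBasis hp
  rintro ⟨l, rfl⟩
  have h := (coord_openSegment b hz hij).1
  rw [b.coord_apply] at h
  split_ifs at h
  · exact absurd h.2 (lt_irrefl _)
  · exact absurd h.1 (lt_irrefl _)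

theorem segment_subset_triangle (i j : Fin 3) :
    segment ℝ (p i) (p j) ⊆ convexHull ℝ (Set.range p) :=
  segment_subset_convexHull ⟨i, rfl⟩ ⟨j, rfl⟩

/-- The endpoints are recovered as what the closure adds to the open segment. -/
theorem openSegment_eq_openSegment {a b a' b' : Plane} (hab : a ≠ b) (hab' : a' ≠ b')
    (h : openSegment ℝ a b = openSegment ℝ a' b') :
    (a = a' ∧ b = b') ∨ (a = b' ∧ b = a') := by
  have key : ∀ {a b : Plane}, a ≠ b →
      closure (openSegment ℝ a b) \ openSegment ℝ a b = {a, b} := by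
    intro a b hab
    rw [closure_openSegment, ← insert_endpoints_openSegment]
    ext x
    simp only [Set.mem_sdiff, Set.mem_insert_iff, Set.mem_singleton_iff]
    constructor
    · tauto
    · rintro (rfl | rfl)
      · exact ⟨Or.inl rfl, fun h => hab (left_mem_openSegment_iff.1 h)⟩
      · exact ⟨Or.inr (Or.inl rfl), fun h => hab (right_mem_openSegment_iff.1 h)⟩
  have h1 := key hab
  rw [h, key hab'] at h1
  exact Set.pair_eq_pair_iff.1 h1.symm

end Triangle

/-! ### Geodesic triangulations -/

namespace GeodesicTriangulation

variable {S : Type*} [MetricSpace S] [ChartedSpace Plane S] {ι : Type*}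
  (T : GeodesicTriangulation S ι)

/-- The Euclidean triangle with index `k`. -/
def triangle (k : ι) : Set Plane := convexHull ℝ (Set.range (T.vert k))

theorem isCompact_triangle (k : ι) : IsCompact (T.triangle k) :=
  (Set.finite_range _).isCompact_convexHull ℝ

theorem convex_triangle (k : ι) : Convex ℝ (T.triangle k) := convex_convexHull ℝ _

theorem vert_mem_triangle (k : ι) (j : Fin 3) : T.vert k j ∈ T.triangle k :=
  subset_convexHull ℝ _ ⟨j, rfl⟩

theorem map_vert_mem (k : ι) (j : Fin 3) : T.map k (T.vert k j) ∈ singularSet S := by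
  rw [← T.vertices]
  exact ⟨k, j, rfl⟩

theorem notMem_range_vert {k : ι} {z : Plane} {x : S} (h : T.map k z = x) :
    z ∉ Set.range (T.vert k) := by
  rintro ⟨j, rfl⟩
  exact coe_notMem_singularSet x (h ▸ T.map_vert_mem k j)

theorem exists_coe_eq_map {k : ι} {z : Plane} (hz : z ∈ T.triangle k)
    (hz' : z ∉ Set.range (T.vert k)) : ∃ x : S, T.map k z = x := by
  obtain ⟨x, hx, -⟩ := T.flat k z hz hz'
  exact ⟨x, hx⟩

theorem eventually_liftChart {k : ι} {z : Plane} (hz : z ∈ T.triangle k) {x : S}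
    (hx : T.map k z = x) : ∃ v : Plane, ∀ᶠ w in 𝓝[T.triangle k] z,
      T.map k w ∈ chartDomain x ∧ liftChart x (T.map k w) = w + v := by
  obtain ⟨x', hx', v, hv⟩ := T.flat k z hz (T.notMem_range_vert hx)
  obtain rfl : x' = x := Completion.coe_injective S (hx'.symm.trans hx)
  simp only [exists_mem_source_iff] at hv
  exact ⟨v, hv⟩

theorem eventually_sub_eq_sub {D : Completion S → Plane} {U : Set (Completion S)}
    (hD : IsFlatCoordinate D U) {x : S} (hxU : (x : Completion S) ∈ U) {k : ι} {z : Plane}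
    (hz : z ∈ T.triangle k) (hx : T.map k z = x) :
    ∀ᶠ w in 𝓝[T.triangle k] z, D (T.map k w) - D x = w - z := by
  obtain ⟨v, hv⟩ := T.eventually_liftChart hz hx
  obtain ⟨u, hu⟩ := hD.eventually_eq_liftChart hxU
  have hu' : ∀ᶠ w in 𝓝[T.triangle k] z, D (T.map k w) = liftChart x (T.map k w) + u :=
    (T.continuousOn k z hz).eventually (by rwa [hx])
  have h0 := hv.self_of_nhdsWithin hz
  filter_upwards [hv, hu'] with w h1 h2
  rw [h2, h1.2, ← hx, hu'.self_of_nhdsWithin hz, h0.2]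
  abel

/-- The set `K` is arbitrary because the statement is needed for a closed edge as well as for a
whole triangle. -/
theorem eventually_exists_of_isCompact {D : Completion S → Plane} {U : Set (Completion S)}
    (hD : IsFlatCoordinate D U) {x : S} (hxU : (x : Completion S) ∈ U) {k : ι} {K : Set Plane}
    (hK : IsCompact K) (hKT : K ⊆ T.triangle k) :
    ∀ᶠ q in 𝓝 (x : Completion S), ∀ w ∈ K, T.map k w = q →
      ∃ z ∈ K, T.map k z = x ∧ D q - D x = w - z := by
  refine eventually_of_preimage_isCompact
    (P := fun q w => ∃ z ∈ K, T.map k z = x ∧ D q - D x = w - z) hK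
    ((T.continuousOn k).mono hKT) fun z hz hzx => ?_
  filter_upwards [nhdsWithin_mono z hKT (T.eventually_sub_eq_sub hD hxU (hKT hz) hzx)] with w hw
  exact ⟨z, hz, hzx, hw⟩

/-- Near a regular point, the triangulation looks in a flat coordinate like the union of the
corresponding parts of the Euclidean triangles. -/
theorem eventually_exists {D : Completion S → Plane} {U : Set (Completion S)}
    (hD : IsFlatCoordinate D U) {x : S} (hxU : (x : Completion S) ∈ U) :
    ∀ᶠ q in 𝓝 (x : Completion S), ∀ k, ∀ w ∈ T.triangle k, T.map k w = q →
      ∃ z ∈ T.triangle k, T.map k z = x ∧ D q - D x = w - z := by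
  obtain ⟨V, hV, hfin⟩ := T.locallyFinite x
  -- Local finiteness leaves finitely many triangles, and each of them is compact.
  have h := (eventually_all_finite hfin).2 fun k _ =>
    T.eventually_exists_of_isCompact hD hxU (T.isCompact_triangle k) subset_rfl
  filter_upwards [hV, h] with q hqV hq k w hw hwq
  exact hq k ⟨q, ⟨w, hw, hwq⟩, hqV⟩ w hw hwq

/-! ### Shared edges -/

/-- The open edge of the triangle `k` that is opposite to the vertex `j`. -/
def edge (k : ι) (j : Fin 3) : Set Plane := openSegment ℝ (T.vert k (j + 1)) (T.vert k (j + 2))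

theorem add_one_ne_add_two (j : Fin 3) : j + 1 ≠ j + 2 := by
  decide +revert

theorem ne_add_one (j : Fin 3) : j ≠ j + 1 := by
  decide +revert

theorem ne_add_two (j : Fin 3) : j ≠ j + 2 := by
  decide +revert

theorem eq_or_eq_add (i j : Fin 3) : i = j ∨ i = j + 1 ∨ i = j + 2 := by
  decide +revert

theorem edge_subset (k : ι) (j : Fin 3) : T.edge k j ⊆ T.triangle k :=
  (openSegment_subset_segment ℝ _ _).trans (segment_subset_triangle _ _)

theorem vert_injective (k : ι) : Function.Injective (T.vert k) :=
  (T.affineIndependent k).injective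

theorem eq_or_mem_edge {k l : ι} {z w : Plane} (hz : z ∈ T.triangle k) (hw : w ∈ T.triangle l)
    {x : S} (hzx : T.map k z = x) (hwx : T.map l w = x) :
    (k = l ∧ z = w) ∨ ∃ j m, z ∈ T.edge k j ∧ w ∈ T.edge l m := by
  rcases mem_triangle_cases (T.affineIndependent k) hz with h | h | ⟨j, h⟩
  · exact Or.inl (T.interior_inj k l z h w hw (hzx.trans hwx.symm))
  · exact absurd h (T.notMem_range_vert hzx)
  rcases mem_triangle_cases (T.affineIndependent l) hw with h' | h' | ⟨m, h'⟩
  · have := T.interior_inj l k w h' z hz (hwx.trans hzx.symm)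
    exact Or.inl ⟨this.1.symm, this.2.symm⟩
  · exact absurd h' (T.notMem_range_vert hwx)
  · exact Or.inr ⟨j, m, h, h'⟩

/-- Two edges that share a point of the surface are translates of each other. -/
theorem edge_translate [TranslationSurface S] {k l : ι} {j m : Fin 3} {z w : Plane}
    (hz : z ∈ T.edge k j) (hw : w ∈ T.edge l m) (h : T.map k z = T.map l w) :
    (T.vert l (m + 1) = T.vert k (j + 1) + (w - z) ∧
      T.vert l (m + 2) = T.vert k (j + 2) + (w - z)) ∨
    (T.vert l (m + 1) = T.vert k (j + 2) + (w - z) ∧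
      T.vert l (m + 2) = T.vert k (j + 1) + (w - z)) := by
  have himg : T.map k '' T.edge k j = T.map l '' T.edge l m := by
    refine (T.edge_eq_or_disjoint k j l m).resolve_right fun hd => ?_
    exact Set.disjoint_left.1 hd ⟨z, hz, rfl⟩ ⟨w, hw, h.symm⟩
  have hex : ∀ a ∈ T.edge k j, ∃ b ∈ T.edge l m, T.map l b = T.map k a := by
    intro a ha
    have : T.map k a ∈ T.map l '' T.edge l m := himg ▸ ⟨a, ha, rfl⟩
    exact this
  -- `φ` identifies the two open edges through their common image in the surface. It is shown to be
  -- the translation by `w - z`; its continuity is not known beforehand.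
  choose! φ hφ hφmap using hex
  have hφz : φ z = w := T.edge_inj l m (hφ z hz) hw ((hφmap z hz).trans h)
  have hconst : ∀ a ∈ T.edge k j, φ a - a = w - z := by
    intro a ha
    rw [← hφz]
    refine eq_of_eventually_of_isPreconnected (f := fun a => φ a - a)
      (convex_openSegment (T.vert k (j + 1)) (T.vert k (j + 2))).isPreconnected ?_ ha hz
    intro a ha
    obtain ⟨x, hx⟩ := T.exists_coe_eq_map (T.edge_subset k j ha)
      (openSegment_notMem_range (T.affineIndependent k) (add_one_ne_add_two j) ha)
    have hD := isFlatCoordinate_liftChart x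
    have h1 := nhdsWithin_mono a (T.edge_subset k j)
      (T.eventually_sub_eq_sub hD (mem_chartDomain x) (T.edge_subset k j ha) hx)
    -- Compactness requires the closed edge; its ends are discarded below because they map to
    -- singularities. For `b` near `a`, `φ b` is then the translate by `b - a` of a point over `x`,
    -- which is `φ a` since the edge is embedded.
    have hK : segment ℝ (T.vert l (m + 1)) (T.vert l (m + 2)) ⊆ T.triangle l :=
      segment_subset_triangle _ _
    have h2 := T.eventually_exists_of_isCompact hD (mem_chartDomain x)
      (by rw [← convexHull_pair]; exact (Set.toFinite _).isCompact_convexHull ℝ) hK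
    have hcont : Tendsto (T.map k) (𝓝[T.edge k j] a) (𝓝 x) := by
      rw [← hx]
      exact (T.continuousOn k a (T.edge_subset k j ha)).mono (T.edge_subset k j)
    filter_upwards [h1, hcont.eventually h2, self_mem_nhdsWithin] with b hb1 hb2 hb
    obtain ⟨y, hy, hyx, hsub⟩ := hb2 (φ b) (openSegment_subset_segment ℝ _ _ (hφ b hb))
      (hφmap b hb)
    have hyedge : y ∈ T.edge l m := by
      rw [← insert_endpoints_openSegment] at hy
      rcases hy with rfl | rfl | hy
      · exact absurd ⟨_, rfl⟩ (T.notMem_range_vert hyx)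
      · exact absurd ⟨_, rfl⟩ (T.notMem_range_vert hyx)
      · exact hy
    have hya : φ a = y := T.edge_inj l m (hφ a ha) hyedge ((hφmap a ha).trans (hx.trans hyx.symm))
    rw [hya]
    have h3 : b - a = φ b - y := hb1.symm.trans hsub
    rw [sub_eq_sub_iff_add_eq_add] at h3 ⊢
    exact h3.symm.trans (add_comm _ _)
  have hset : T.edge l m = openSegment ℝ (T.vert k (j + 1) + (w - z))
      (T.vert k (j + 2) + (w - z)) := by
    have htr : openSegment ℝ (T.vert k (j + 1) + (w - z)) (T.vert k (j + 2) + (w - z)) =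
        (fun a => (w - z) + a) '' T.edge k j := by
      rw [edge, openSegment_translate_image, add_comm (w - z), add_comm (w - z)]
    rw [htr]
    ext b
    constructor
    · intro hb
      have : T.map l b ∈ T.map k '' T.edge k j := himg ▸ ⟨b, hb, rfl⟩
      obtain ⟨a, ha, hab⟩ := this
      refine ⟨a, ha, ?_⟩
      rw [← T.edge_inj l m (hφ a ha) hb ((hφmap a ha).trans hab)]
      simp only [← hconst a ha, sub_add_cancel]
    · rintro ⟨a, ha, rfl⟩
      simp only [← hconst a ha, sub_add_cancel]
      exact hφ a ha
  have hne : T.vert l (m + 1) ≠ T.vert l (m + 2) := fun h =>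
    add_one_ne_add_two m (T.vert_injective l h)
  have hne' : T.vert k (j + 1) + (w - z) ≠ T.vert k (j + 2) + (w - z) := fun h =>
    add_one_ne_add_two j (T.vert_injective k (add_right_cancel h))
  exact openSegment_eq_openSegment hne hne' hset

end GeodesicTriangulation

namespace GeodesicTriangulation

variable {S : Type*} [MetricSpace S] [ChartedSpace Plane S] {ι : Type*}
  (T : GeodesicTriangulation S ι)

/-! ### Straight paths in the triangles -/

/-- A straight path in a triangle is straight in the charts. -/
theorem eventually_liftChart_comp {k : ι} {f : I → Plane} {A : Set I} {v u : Plane}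
    (hf : ∀ s ∈ A, f s = (s : ℝ) • v + u) (hA : Set.MapsTo f A (T.triangle k)) {t : I} (ht : t ∈ A)
    {x : S} (hx : T.map k (f t) = x) :
    ∃ w : Plane, ∀ᶠ s in 𝓝[A] t, T.map k (f s) ∈ chartDomain x ∧
      liftChart x (T.map k (f s)) = (s : ℝ) • v + w := by
  obtain ⟨w, hw⟩ := T.eventually_liftChart (hA ht) hx
  have hfc : ContinuousWithinAt f A t := by
    refine ContinuousWithinAt.congr (f := fun s : I => (s : ℝ) • v + u) ?_ hf (hf t ht)
    exact Continuous.continuousWithinAt (by fun_prop)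
  refine ⟨u + w, ?_⟩
  filter_upwards [(hfc.tendsto_nhdsWithin hA).eventually hw, self_mem_nhdsWithin] with s hs hsA
  rw [← add_assoc, ← hf s hsA]
  exact hs

theorem lineMap_mem_openSegment {a b : Plane} {t : I} (h0 : t ≠ 0) (h1 : t ≠ 1) :
    (t : ℝ) • (b - a) + a ∈ openSegment ℝ a b := by
  refine ⟨1 - t, t, sub_pos.2 (unitInterval.lt_one_iff_ne_one.2 h1),
    unitInterval.pos_iff_ne_zero.2 h0, by ring, ?_⟩
  rw [sub_smul, one_smul, smul_sub]
  abel

theorem lineMap_mem_segment {a b : Plane} (t : I) :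
    (t : ℝ) • (b - a) + a ∈ segment ℝ a b := by
  refine ⟨1 - t, t, sub_nonneg.2 t.2.2, t.2.1, by ring, ?_⟩
  rw [sub_smul, one_smul, smul_sub]
  abel

/-- The path itself is needed again in `eventually_position`, to approach a singularity. -/
theorem exists_edge_path (k : ι) {i j : Fin 3} (hij : i ≠ j) :
    ∃ γ : C(I, Completion S),
      (∀ t : I, γ t = T.map k ((t : ℝ) • (T.vert k j - T.vert k i) + T.vert k i)) ∧
      ∀ t : I, t ≠ 0 → t ≠ 1 → ∃ x : S, γ t = (x : Completion S) ∧
        ∃ w : Plane, ∀ᶠ s : I in 𝓝 t, ∃ y ∈ (chartAt Plane x).source,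
          γ s = (y : Completion S) ∧
            chartAt Plane x y = (s : ℝ) • (T.vert k j - T.vert k i) + w := by
  set f : I → Plane := fun t => (t : ℝ) • (T.vert k j - T.vert k i) + T.vert k i with hf
  have hmem : ∀ t, f t ∈ T.triangle k := fun t =>
    segment_subset_triangle i j (lineMap_mem_segment t)
  have hfc : Continuous f := by fun_prop
  refine ⟨⟨fun t => T.map k (f t), (T.continuousOn k).comp_continuous hfc hmem⟩,
    fun t => rfl, fun t h0 h1 => ?_⟩
  obtain ⟨x, hx⟩ := T.exists_coe_eq_map (hmem t) (openSegment_notMem_range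
    (T.affineIndependent k) hij (lineMap_mem_openSegment h0 h1))
  obtain ⟨w, hw⟩ := T.eventually_liftChart_comp (A := Set.univ) (fun s _ => rfl)
    (fun s _ => hmem s) (Set.mem_univ t) hx
  refine ⟨x, hx, w, ?_⟩
  simp only [exists_mem_source_iff]
  rwa [nhdsWithin_univ] at hw

/-- The edges of the triangles are saddle connections. -/
theorem isHolonomyVector_edge (k : ι) {i j : Fin 3} (hij : i ≠ j) :
    IsHolonomyVector S (T.vert k j - T.vert k i) := by
  obtain ⟨γ, hγ, h⟩ := T.exists_edge_path k hij
  refine ⟨sub_ne_zero.2 fun h => hij (T.vert_injective k h).symm, γ, ?_, ?_, h⟩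
  · rw [hγ]
    simpa using T.map_vert_mem k i
  · rw [hγ]
    simpa using T.map_vert_mem k j

/-! ### Positions modulo the holonomy of the edges -/

/-- The subgroup generated by the edges of the triangles. -/
def edgeGroup : AddSubgroup Plane :=
  AddSubgroup.closure {v | ∃ k i j, v = T.vert k j - T.vert k i}

theorem vert_sub_vert_mem (k : ι) (i j : Fin 3) : T.vert k j - T.vert k i ∈ T.edgeGroup :=
  AddSubgroup.subset_closure ⟨k, i, j, rfl⟩

theorem exists_vert_eq_of_mem_singularSet {k : ι} {z : Plane} (hz : z ∈ T.triangle k)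
    (h : T.map k z ∈ singularSet S) : ∃ j, T.vert k j = z := by
  by_contra hne
  obtain ⟨x, hx⟩ := T.exists_coe_eq_map hz (by simpa using hne)
  exact coe_notMem_singularSet x (hx ▸ h)

variable [TranslationSurface S]

/-- This makes `position` independent of the triangle. Over a singularity both points are vertices.
Over a regular point they either coincide or lie on edges that are translates by `w - z`, so that
the difference reduces to one between vertices. -/
theorem sub_sub_sub_mem_edgeGroup {k l : ι} {z w : Plane} (hz : z ∈ T.triangle k)
    (hw : w ∈ T.triangle l) (h : T.map k z = T.map l w) :
    (w - T.vert l 0) - (z - T.vert k 0) ∈ T.edgeGroup := by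
  by_cases hs : T.map k z ∈ singularSet S
  · obtain ⟨i, rfl⟩ := T.exists_vert_eq_of_mem_singularSet hz hs
    obtain ⟨j, rfl⟩ := T.exists_vert_eq_of_mem_singularSet hw (h ▸ hs)
    exact sub_mem (T.vert_sub_vert_mem _ _ _) (T.vert_sub_vert_mem _ _ _)
  obtain ⟨x, hx⟩ := notMem_singularSet.1 hs
  rcases T.eq_or_mem_edge hz hw hx.symm (h.symm.trans hx.symm) with ⟨rfl, rfl⟩ | ⟨j, m, hj, hm⟩
  · rw [sub_self]
    exact zero_mem _
  have key : ∃ i, T.vert l (m + 1) = T.vert k i + (w - z) := by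
    rcases T.edge_translate hj hm h with ⟨h1, -⟩ | ⟨h1, -⟩
    exacts [⟨_, h1⟩, ⟨_, h1⟩]
  obtain ⟨i, hi⟩ := key
  have : (w - T.vert l 0) - (z - T.vert k 0) =
      (T.vert l (m + 1) - T.vert l 0) - (T.vert k i - T.vert k 0) := by
    rw [hi]
    abel
  rw [this]
  exact sub_mem (T.vert_sub_vert_mem _ _ _) (T.vert_sub_vert_mem _ _ _)

/-- The position of a point relative to a vertex of a triangle that contains it, modulo the
vectors of the edges. -/
def position (p : Completion S) : Plane ⧸ T.edgeGroup :=
  QuotientAddGroup.mk' T.edgeGroup ((T.cover p).choose_spec.choose - T.vert (T.cover p).choose 0)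

theorem position_map {k : ι} {z : Plane} (hz : z ∈ T.triangle k) :
    T.position (T.map k z) = QuotientAddGroup.mk' T.edgeGroup (z - T.vert k 0) := by
  have h := (T.cover (T.map k z)).choose_spec.choose_spec
  rw [position, QuotientAddGroup.mk'_apply, QuotientAddGroup.mk'_apply, QuotientAddGroup.eq,
    neg_add_eq_sub]
  exact T.sub_sub_sub_mem_edgeGroup h.1 hz h.2

theorem position_of_mem_singularSet {p : Completion S} (hp : p ∈ singularSet S) :
    T.position p = 0 := by
  rw [← T.vertices] at hp
  obtain ⟨k, j, rfl⟩ := hp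
  rw [T.position_map (T.vert_mem_triangle k j), QuotientAddGroup.mk'_apply,
    QuotientAddGroup.eq_zero_iff]
  exact T.vert_sub_vert_mem _ _ _

theorem eventually_position_of_coe {D : Completion S → Plane} {U : Set (Completion S)}
    (hD : IsFlatCoordinate D U) {x : S} (hxU : (x : Completion S) ∈ U) :
    ∀ᶠ q in 𝓝 (x : Completion S), QuotientAddGroup.mk' T.edgeGroup (D q) - T.position q =
      QuotientAddGroup.mk' T.edgeGroup (D x) - T.position x := by
  filter_upwards [T.eventually_exists hD hxU] with q hq
  obtain ⟨k, w, hw, rfl⟩ := T.cover q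
  obtain ⟨z, hz, hzx, hsub⟩ := hq k w hw rfl
  rw [T.position_map hw, ← hzx, T.position_map hz, ← map_sub, ← map_sub, hzx]
  congr 1
  rw [sub_eq_iff_eq_add] at hsub
  rw [hsub]
  abel

/-- On a neighbourhood of any point, flat coordinates and positions differ by a constant. -/
theorem eventually_position (hS : IsTame S) {D : Completion S → Plane} {U : Set (Completion S)}
    (hD : IsFlatCoordinate D U) {p : Completion S} (hU : U ∈ 𝓝 p) :
    ∀ᶠ q in 𝓝 p, QuotientAddGroup.mk' T.edgeGroup (D q) - T.position q =
      QuotientAddGroup.mk' T.edgeGroup (D p) - T.position p := by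
  by_cases hp : p ∈ singularSet S
  swap
  · obtain ⟨x, rfl⟩ := notMem_singularSet.1 hp
    exact T.eventually_position_of_coe hD (mem_of_mem_nhds hU)
  obtain ⟨n, hn⟩ := hS p hp
  obtain ⟨ε, hε, -, -, hpunct⟩ := hn.exists_isFlatCoordinate hp
  obtain ⟨ε₁, hε₁, hball⟩ := Metric.mem_nhds_iff.1 hU
  set ε' := min ε ε₁
  have hε' : 0 < ε' := lt_min hε hε₁
  obtain ⟨hconn, hrange⟩ := hpunct ε' (min_le_left _ _)
  have hsub : Metric.ball p ε' ⊆ U :=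
    (Metric.ball_subset_ball (min_le_right _ _)).trans hball
  -- No continuity of `position` at `p` is available. Constancy is shown on the punctured ball, and
  -- the value at `p` is then compared with that at a single nearby point.
  have hconst : ∀ q ∈ Metric.ball p ε' \ {p}, ∀ q' ∈ Metric.ball p ε' \ {p},
      QuotientAddGroup.mk' T.edgeGroup (D q) - T.position q =
        QuotientAddGroup.mk' T.edgeGroup (D q') - T.position q' := by
    intro q hq q' hq'
    refine eq_of_eventually_of_isPreconnected
      (f := fun q => QuotientAddGroup.mk' T.edgeGroup (D q) - T.position q) hconn ?_ hq hq'
    intro y hy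
    obtain ⟨x, rfl⟩ := hrange hy
    exact (T.eventually_position_of_coe hD (hsub hy.1)).filter_mono nhdsWithin_le_nhds
  suffices H : ∃ q ∈ Metric.ball p ε' \ {p},
      QuotientAddGroup.mk' T.edgeGroup (D q) - T.position q =
        QuotientAddGroup.mk' T.edgeGroup (D p) - T.position p by
    obtain ⟨q, hq, hqp⟩ := H
    filter_upwards [Metric.ball_mem_nhds p hε'] with y hy
    by_cases hyp : y = p
    · rw [hyp]
    · rw [← hqp]
      exact hconst y ⟨hy, hyp⟩ q hq
  -- approach `p` along an edge
  have hp' := hp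
  rw [← T.vertices] at hp'
  obtain ⟨k, j, hj⟩ := hp'
  have hne : j ≠ j + 1 := ne_add_one j
  obtain ⟨γ, hγ, h⟩ := T.exists_edge_path k hne
  have hγ0 : γ 0 = p := by
    rw [hγ, ← hj]
    simp
  -- In the coordinate `D'` the edge starts as `s • v`, which is also its change of position; `D`
  -- differs from `D'` by a constant near `p`.
  obtain ⟨V, D', hV, hγV, hD', hev⟩ := exists_isFlatCoordinate_eventually_smul_eq hS h
  rw [hγ0] at hγV
  have hDD' := hD'.eventually_sub_eq hS hD (hV.mem_nhds hγV) hU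
  have hγt : Tendsto γ (𝓝 0) (𝓝 p) := by
    rw [← hγ0]
    exact γ.continuous.tendsto 0
  have hfreq : ∃ᶠ s : I in 𝓝 0, s ≠ 0 := by
    have : (𝓝[≠] (0 : I)).NeBot := inferInstance
    exact frequently_iff_neBot.2 this
  have hlt : ∀ᶠ s : I in 𝓝 0, s < 1 := gt_mem_nhds zero_lt_one
  obtain ⟨s, hs0, hs1, hs2, hs3, hs4⟩ := (hfreq.and_eventually (hlt.and (hev.and
    ((hγt.eventually hDD').and (hγt.eventually (Metric.ball_mem_nhds p hε')))))).exists
  obtain ⟨x, hx, -⟩ := h s hs0 hs1.ne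
  refine ⟨γ s, ⟨hs4, fun hsp => hp ⟨x, hx.symm.trans hsp⟩⟩, ?_⟩
  have hDp : D' p = 0 := by
    have := hev.self_of_nhds
    rw [hγ0] at this
    simpa using this.symm
  have hmem : (s : ℝ) • (T.vert k (j + 1) - T.vert k j) + T.vert k j ∈ T.triangle k :=
    segment_subset_triangle _ _ (lineMap_mem_segment s)
  have hpos : T.position p = QuotientAddGroup.mk' T.edgeGroup (T.vert k j - T.vert k 0) := by
    rw [← hj, T.position_map (T.vert_mem_triangle k j)]
  have hpos' : T.position (γ s) = QuotientAddGroup.mk' T.edgeGroup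
      ((s : ℝ) • (T.vert k (j + 1) - T.vert k j) + T.vert k j - T.vert k 0) := by
    rw [hγ, T.position_map hmem]
  rw [hpos, hpos', ← map_sub, ← map_sub]
  congr 1
  rw [← hs2, hDp, sub_zero, sub_eq_iff_eq_add] at hs3
  rw [hs3]
  abel

/-- Along the path, development minus position is locally constant, hence constant. -/
theorem mk_holonomy (hS : IsTame S) (γ : C(I, Completion S)) :
    QuotientAddGroup.mk' T.edgeGroup (holonomy γ) = T.position (γ 1) - T.position (γ 0) := by
  obtain ⟨δ, hδ⟩ := hS.exists_isExtendedDevelopment γ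
  rw [hδ.holonomy_eq hS, map_sub]
  have h := eq_of_eventually_of_isPreconnected (A := (Set.univ : Set I))
    (f := fun t => QuotientAddGroup.mk' T.edgeGroup (δ t) - T.position (γ t))
    isPreconnected_univ (fun t _ => ?_) (Set.mem_univ 0) (Set.mem_univ 1)
  · rw [sub_eq_sub_iff_add_eq_add] at h ⊢
    rw [← h, add_comm]
  · rw [nhdsWithin_univ]
    obtain ⟨U, D, hU, hγU, hD, hev⟩ := hδ t
    filter_upwards [hev, (γ.continuous.tendsto t).eventually
      (T.eventually_position hS hD (hU.mem_nhds hγU))] with s h1 h2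
    rw [h1, h2, hev.self_of_nhds]

/-- The relative homology is generated by the edges, as far as holonomy is concerned. -/
theorem relativeHolonomy_le (hS : IsTame S) : relativeHolonomy S ≤ T.edgeGroup := by
  rintro _ ⟨c, hc, rfl⟩
  have hc' : boundary _ c ∈ Finsupp.supported ℤ ℤ (singularSet S) := hc
  rw [← QuotientAddGroup.eq_zero_iff]
  let P : (Completion S →₀ ℤ) →+ Plane ⧸ T.edgeGroup :=
    Finsupp.liftAddHom fun p => zmultiplesHom _ (T.position p)
  -- Modulo edges, holonomy factors through the boundary, and `P` kills chains supported on `Σ`.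
  have h : (QuotientAddGroup.mk' T.edgeGroup).comp (chainHolonomy S) =
      P.comp (boundary (Completion S)) := by
    ext γ
    simp only [AddMonoidHom.comp_apply, Finsupp.singleAddHom_apply, chainHolonomy, boundary,
      Finsupp.liftAddHom_apply_single, AddMonoidHom.sub_apply, map_sub, P, zmultiplesHom_apply,
      one_smul]
    exact T.mk_holonomy hS γ
  have h0 : P (boundary _ c) = 0 := by
    simp only [P, Finsupp.liftAddHom_apply]
    refine Finset.sum_eq_zero fun p hp => ?_
    have hpS : p ∈ singularSet S := (Finsupp.mem_supported ℤ _).1 hc' hp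
    simp [T.position_of_mem_singularSet hpS]
  exact (DFunLike.congr_fun h c).trans h0

end GeodesicTriangulation

/-! ### Determinants -/

theorem det_add_left (u v w : Plane) : det (u + v) w = det u w + det v w := by
  simp only [det, PiLp.add_apply]; ring

theorem det_add_right (u v w : Plane) : det u (v + w) = det u v + det u w := by
  simp only [det, PiLp.add_apply]; ring

theorem det_sub_left (u v w : Plane) : det (u - v) w = det u w - det v w := by
  simp only [det, PiLp.sub_apply]; ring

theorem det_sub_right (u v w : Plane) : det u (v - w) = det u v - det u w := by
  simp only [det, PiLp.sub_apply]; ring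

theorem det_smul_left (c : ℝ) (u v : Plane) : det (c • u) v = c * det u v := by
  simp only [det, PiLp.smul_apply, smul_eq_mul]; ring

theorem det_smul_right (c : ℝ) (u v : Plane) : det u (c • v) = c * det u v := by
  simp only [det, PiLp.smul_apply, smul_eq_mul]; ring

theorem det_self (u : Plane) : det u u = 0 := by
  simp only [det]; ring

theorem det_swap (u v : Plane) : det u v = -det v u := by
  simp only [det]; ring

/-- Cramer's rule, free of division. -/
theorem det_smul_eq (u v w : Plane) : det u v • w = det w v • u + det u w • v := by
  ext i
  fin_cases i <;>
  · simp only [det, PiLp.add_apply, PiLp.smul_apply, smul_eq_mul, Fin.zero_eta, Fin.mk_one]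
    ring

theorem exists_eq_smul_of_det_eq_zero {u v : Plane} (hu : u ≠ 0) (h : det u v = 0) :
    ∃ c : ℝ, v = c • u := by
  have h' : u 0 * v 1 = u 1 * v 0 := sub_eq_zero.1 h
  by_cases h0 : u 0 = 0
  · have h1 : u 1 ≠ 0 := by
      intro h1
      exact hu (by ext i; fin_cases i <;> simp [h0, h1])
    refine ⟨v 1 / u 1, ?_⟩
    have : v 0 = 0 := by
      rw [h0, zero_mul] at h'
      exact (mul_eq_zero.1 h'.symm).resolve_left h1
    ext i
    fin_cases i
    · simp [h0, this]
    · simp [h1]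
  · refine ⟨v 0 / u 0, ?_⟩
    ext i
    fin_cases i
    · simp [h0]
    · simp only [PiLp.smul_apply, smul_eq_mul, Fin.mk_one]
      field_simp
      linarith

theorem linearIndependent_of_det_ne_zero {u v : Plane} (h : det u v ≠ 0) :
    LinearIndependent ℝ ![u, v] := by
  rw [LinearIndependent.pair_iff]
  intro s t hst
  have h1 : det (s • u + t • v) v = 0 := by rw [hst]; simp [det]
  have h2 : det u (s • u + t • v) = 0 := by rw [hst]; simp [det]
  rw [det_add_left, det_smul_left, det_smul_left, det_self, mul_zero, add_zero] at h1
  rw [det_add_right, det_smul_right, det_smul_right, det_self, mul_zero, zero_add] at h2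
  exact ⟨(mul_eq_zero.1 h1).resolve_right h, (mul_eq_zero.1 h2).resolve_right h⟩

/-- Otherwise the third vertex would lie on the line through the other two, where its own
barycentric coordinate is `0` instead of `1`. -/
theorem det_ne_zero_of_affineIndependent {p : Fin 3 → Plane} (hp : AffineIndependent ℝ p)
    {i j l : Fin 3} (hij : i ≠ j) (hil : i ≠ l) (hjl : j ≠ l) :
    det (p j - p i) (p l - p i) ≠ 0 := by
  intro h
  have hne : p j - p i ≠ 0 := sub_ne_zero.2 fun h => hij (hp.injective h).symm
  obtain ⟨c, hc⟩ := exists_eq_smul_of_det_eq_zero hne h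
  obtain ⟨b, rfl⟩ := exists_affineBasis hp
  have hl : b l = AffineMap.lineMap (b i) (b j) c := by
    rw [AffineMap.lineMap_apply_module', ← hc, sub_add_cancel]
  have := congrArg (b.coord l) hl
  rw [AffineMap.apply_lineMap, b.coord_apply_eq, b.coord_apply_ne hil.symm,
    b.coord_apply_ne hjl.symm] at this
  simp at this

/-- A triangle lies on one side of the line through two of its vertices. -/
theorem det_mul_det_nonneg {p : Fin 3 → Plane} {i j l : Fin 3} (h : ∀ m, m = i ∨ m = j ∨ m = l)
    {v : Plane} (hv : v ∈ convexHull ℝ (Set.range p)) :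
    0 ≤ det (p j - p i) (v - p i) * det (p j - p i) (p l - p i) := by
  have hconv : Convex ℝ {v : Plane |
      0 ≤ det (p j - p i) (v - p i) * det (p j - p i) (p l - p i)} := by
    intro x hx y hy s t hs ht hst
    simp only [Set.mem_ofPred_eq] at hx hy ⊢
    have : s • x + t • y - p i = s • (x - p i) + t • (y - p i) := by
      have h1 : p i = (s + t) • p i := by rw [hst, one_smul]
      rw [smul_sub, smul_sub, sub_add_sub_comm, ← add_smul, ← h1]
    rw [this, det_add_right, det_smul_right, det_smul_right, add_mul, mul_assoc, mul_assoc]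
    exact add_nonneg (mul_nonneg hs hx) (mul_nonneg ht hy)
  refine convexHull_min ?_ hconv hv
  rintro _ ⟨m, rfl⟩
  simp only [Set.mem_ofPred_eq]
  rcases h m with rfl | rfl | rfl
  · simp [det]
  · rw [det_self, zero_mul]
  · exact mul_self_nonneg _

/-- The barycentric coordinate of `y` at `j` is strictly between `0` and `1`, which happens at no
vertex. -/
theorem openSegment_opposite_notMem_range {p : Fin 3 → Plane} (hp : AffineIndependent ℝ p)
    {j : Fin 3} {z y : Plane} (hz : z ∈ openSegment ℝ (p (j + 1)) (p (j + 2)))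
    (hy : y ∈ openSegment ℝ (p j) z) : y ∉ Set.range p := by
  obtain ⟨b, rfl⟩ := exists_affineBasis hp
  have hz0 : b.coord j z = 0 :=
    (coord_openSegment b hz (GeodesicTriangulation.add_one_ne_add_two j)).2 j
      (GeodesicTriangulation.ne_add_one j) (GeodesicTriangulation.ne_add_two j)
  obtain ⟨s, t, hs, ht, hst, rfl⟩ := hy
  rintro ⟨l, hl⟩
  have h : b.coord j (s • b j + t • z) = s := by
    have := Convex.combo_affine_apply (f := b.coord j) (x := b j) (y := z) hst
    rw [this, hz0, b.coord_apply_eq]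
    simp
  rw [← hl, b.coord_apply] at h
  split_ifs at h <;> linarith

/-! ### The second diagonal of a parallelogram -/

namespace GeodesicTriangulation

variable {S : Type*} [MetricSpace S] [ChartedSpace Plane S] {ι : Type*}
  (T : GeodesicTriangulation S ι)

/-- If two triangles that share a point of an edge form a parallelogram with centre this point,
then the second diagonal of the parallelogram is a saddle connection. -/
theorem isHolonomyVector_diagonal {k l : ι} {j m : Fin 3} {z w u : Plane}
    (hz : z ∈ T.edge k j) (hw : w ∈ T.edge l m) (h : T.map k z = T.map l w)
    (hk : T.vert k j = z - u) (hl : T.vert l m = w + u) :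
    IsHolonomyVector S ((2 : ℝ) • u) := by
  have hu : u ≠ 0 := by
    rintro rfl
    rw [sub_zero] at hk
    exact openSegment_notMem_range (T.affineIndependent k) (add_one_ne_add_two j) hz ⟨j, hk⟩
  -- `f` runs to `z` in the first half of the time and then rests; `g` rests at `w` and then runs to
  -- the opposite vertex. The truncation keeps both in their triangles at all times.
  let f : I → Plane := fun t => (min (2 * (t : ℝ)) 1) • u + T.vert k j
  let g : I → Plane := fun t => (max (2 * (t : ℝ) - 1) 0) • u + w
  have hfc : Continuous f := by fun_prop
  have hgc : Continuous g := by fun_prop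
  have hfs : ∀ t, f t ∈ segment ℝ (T.vert k j) z := by
    intro t
    refine ⟨1 - min (2 * (t : ℝ)) 1, min (2 * (t : ℝ)) 1, sub_nonneg.2 (min_le_right _ _),
      le_min (by linarith [t.2.1]) zero_le_one, by ring, ?_⟩
    rw [hk]
    simp only [f, hk]
    module
  have hgs : ∀ t, g t ∈ segment ℝ (T.vert l m) w := by
    intro t
    refine ⟨max (2 * (t : ℝ) - 1) 0, 1 - max (2 * (t : ℝ) - 1) 0, le_max_right _ _,
      sub_nonneg.2 (max_le (by linarith [t.2.2]) zero_le_one), by ring, ?_⟩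
    rw [hl]
    simp only [g]
    module
  have hft : ∀ t, f t ∈ T.triangle k := fun t =>
    (T.convex_triangle k).segment_subset (T.vert_mem_triangle k j) (T.edge_subset k j hz) (hfs t)
  have hgt : ∀ t, g t ∈ T.triangle l := fun t =>
    (T.convex_triangle l).segment_subset (T.vert_mem_triangle l m) (T.edge_subset l m hw) (hgs t)
  have hfe : ∀ t : I, (t : ℝ) ≤ 1 / 2 → f t = (t : ℝ) • ((2 : ℝ) • u) + T.vert k j := by
    intro t ht
    simp only [f]
    rw [min_eq_left (by linarith), smul_smul, mul_comm]
  have hge : ∀ t : I, 1 / 2 ≤ (t : ℝ) → g t = (t : ℝ) • ((2 : ℝ) • u) + (w - u) := by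
    intro t ht
    simp only [g]
    rw [max_eq_left (by linarith)]
    module
  have hmid : ∀ t : I, (t : ℝ) = 1 / 2 → f t = z ∧ g t = w := by
    intro t ht
    rw [hfe t ht.le, hge t ht.ge, ht, hk]
    constructor <;> module
  have hγc : Continuous fun t : I =>
      if (t : ℝ) ≤ 1 / 2 then T.map k (f t) else T.map l (g t) := by
    refine Continuous.if_le ((T.continuousOn k).comp_continuous hfc hft)
      ((T.continuousOn l).comp_continuous hgc hgt) continuous_subtype_val continuous_const ?_
    intro t ht
    rw [(hmid t ht).1, (hmid t ht).2, h]
  refine ⟨smul_ne_zero two_ne_zero hu, ⟨_, hγc⟩, ?_, ?_, ?_⟩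
  · simp only [ContinuousMap.coe_mk, Set.Icc.coe_zero]
    rw [if_pos (by norm_num), hfe 0 (by norm_num)]
    simpa using T.map_vert_mem k j
  · simp only [ContinuousMap.coe_mk, Set.Icc.coe_one]
    rw [if_neg (by norm_num), hge 1 (by norm_num)]
    have : ((1 : I) : ℝ) • ((2 : ℝ) • u) + (w - u) = T.vert l m := by
      rw [hl, Set.Icc.coe_one]; module
    rw [this]
    exact T.map_vert_mem l m
  intro t ht0 ht1
  have hpos : 0 < (t : ℝ) := unitInterval.pos_iff_ne_zero.2 ht0
  have hlt : (t : ℝ) < 1 := unitInterval.lt_one_iff_ne_one.2 ht1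
  simp only [ContinuousMap.coe_mk, exists_mem_source_iff]
  rcases lt_trichotomy (t : ℝ) (1 / 2) with hlt' | heq | hgt'
  · have hft' : f t ∈ openSegment ℝ (T.vert k j) z := by
      refine ⟨1 - 2 * t, 2 * t, by linarith, by linarith, by ring, ?_⟩
      rw [hfe t hlt'.le, hk]
      module
    obtain ⟨x, hx⟩ := T.exists_coe_eq_map (hft t)
      (openSegment_opposite_notMem_range (T.affineIndependent k) hz hft')
    obtain ⟨v, hv⟩ := T.eventually_liftChart_comp (A := {s : I | (s : ℝ) < 1 / 2})
      (fun s hs => hfe s (le_of_lt hs)) (fun s _ => hft s) hlt' hx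
    have hopen : IsOpen {s : I | (s : ℝ) < 1 / 2} := isOpen_lt (by fun_prop) continuous_const
    rw [hopen.nhdsWithin_eq hlt'] at hv
    refine ⟨x, by rw [if_pos hlt'.le, hx], v, ?_⟩
    filter_upwards [hv, hopen.mem_nhds hlt'] with s hs hs'
    rw [if_pos (le_of_lt hs')]
    exact hs
  · obtain ⟨x, hx⟩ := T.exists_coe_eq_map (T.edge_subset k j hz)
      (openSegment_notMem_range (T.affineIndependent k) (add_one_ne_add_two j) hz)
    obtain ⟨v, hv⟩ := T.eventually_liftChart_comp (A := {s : I | (s : ℝ) ≤ 1 / 2})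
      (fun s hs => hfe s hs) (fun s _ => hft s) heq.le (by rw [(hmid t heq).1, hx])
    obtain ⟨v', hv'⟩ := T.eventually_liftChart_comp (A := {s : I | 1 / 2 ≤ (s : ℝ)})
      (fun s hs => hge s hs) (fun s _ => hgt s) heq.ge (by rw [(hmid t heq).2, ← h, hx])
    -- The two halves meet at time `1/2` and have the same velocity, so they have the same affine
    -- expression in the chart.
    have hvv' : v = v' := by
      have h1 := (hv.self_of_nhdsWithin heq.le).2
      have h2 := (hv'.self_of_nhdsWithin heq.ge).2
      rw [(hmid t heq).1] at h1
      rw [(hmid t heq).2, ← h, h1] at h2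
      exact add_left_cancel h2
    subst hvv'
    refine ⟨x, by rw [if_pos heq.le, (hmid t heq).1, hx], v, ?_⟩
    filter_upwards [eventually_nhdsWithin_iff.1 hv, eventually_nhdsWithin_iff.1 hv'] with s h1 h2
    split_ifs with hs
    · exact h1 hs
    · exact h2 (le_of_not_ge hs)
  · have hgt'' : g t ∈ openSegment ℝ (T.vert l m) w := by
      refine ⟨2 * t - 1, 2 - 2 * t, by linarith, by linarith, by ring, ?_⟩
      rw [hge t hgt'.le, hl]
      module
    obtain ⟨x, hx⟩ := T.exists_coe_eq_map (hgt t)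
      (openSegment_opposite_notMem_range (T.affineIndependent l) hw hgt'')
    obtain ⟨v, hv⟩ := T.eventually_liftChart_comp (A := {s : I | 1 / 2 < (s : ℝ)})
      (fun s hs => hge s (le_of_lt hs)) (fun s _ => hgt s) hgt' hx
    have hopen : IsOpen {s : I | 1 / 2 < (s : ℝ)} := isOpen_lt continuous_const (by fun_prop)
    rw [hopen.nhdsWithin_eq hgt'] at hv
    refine ⟨x, by rw [if_neg hgt'.not_ge, hx], v, ?_⟩
    filter_upwards [hv, hopen.mem_nhds hgt'] with s hs hs'
    rw [if_neg (not_le_of_gt hs')]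
    exact hs

end GeodesicTriangulation

/-! ### Four pairwise non-parallel holonomy vectors -/

variable {S : Type*} [MetricSpace S] [ChartedSpace Plane S]

theorem isHolonomyQuadruple_of {a b c d : Plane} (ha : IsHolonomyVector S a)
    (hb : IsHolonomyVector S b) (hc : IsHolonomyVector S c) (hd : IsHolonomyVector S d)
    (hab : det a b ≠ 0) (hac : det a c ≠ 0) (had : det a d ≠ 0) (hbc : det b c ≠ 0)
    (hbd : det b d ≠ 0) (hcd : det c d ≠ 0) : IsHolonomyQuadruple S ![a, b, c, d] := by
  have hswap : ∀ {u v : Plane}, det u v ≠ 0 → det v u ≠ 0 := by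
    intro u v h
    rw [det_swap]
    exact neg_ne_zero.2 h
  refine ⟨fun i => ?_, fun i j hij => ?_⟩
  · fin_cases i <;> assumption
  · fin_cases i <;> fin_cases j <;>
      first
      | exact absurd rfl hij
      | assumption
      | (refine hswap ?_; assumption)

namespace GeodesicTriangulation

variable {ι : Type*} (T : GeodesicTriangulation S ι) [TranslationSurface S]

/-- On the other side of an edge there is a triangle. -/
theorem exists_adjacent {k : ι} {j : Fin 3} {z : Plane} (hz : z ∈ T.edge k j) (u : Plane) :
    ∃ l, ∃ w ∈ T.triangle l, T.map k z = T.map l w ∧ ∃ τ : ℝ, 0 < τ ∧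
      w + τ • u ∈ T.triangle l := by
  obtain ⟨x, hx⟩ := T.exists_coe_eq_map (T.edge_subset k j hz)
    (openSegment_notMem_range (T.affineIndependent k) (add_one_ne_add_two j) hz)
  have h := eventually_nhds_coe.1
    (T.eventually_exists (isFlatCoordinate_liftChart x) (mem_chartDomain x))
  let e := chartAt Plane x
  have hex : e x ∈ e.target := mem_chart_target Plane x
  have hline : Tendsto (fun τ : ℝ => e x + τ • u) (𝓝 0) (𝓝 (e x)) := by
    have : Continuous fun τ : ℝ => e x + τ • u := by fun_prop
    simpa using this.tendsto 0
  have hsymm : Tendsto e.symm (𝓝 (e x)) (𝓝 x) := by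
    have := e.continuousAt_symm hex
    rwa [ContinuousAt, e.left_inv (mem_chart_source Plane x)] at this
  have hev := ((hsymm.comp hline).eventually h).and
    (hline.eventually (e.open_target.mem_nhds hex))
  obtain ⟨τ, ⟨h1, h2⟩, hτ⟩ :=
    ((hev.filter_mono (nhdsWithin_le_nhds (s := Set.Ioi 0))).and self_mem_nhdsWithin).exists
  -- By the local description at `x`, a triangle that covers the nearby point at offset `τ • u` also
  -- contains `x`.
  obtain ⟨l, w', hw', hw'q⟩ := T.cover (e.symm (e x + τ • u) : S)
  obtain ⟨w, hw, hwx, hsub⟩ := h1 l w' hw' hw'q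
  refine ⟨l, w, hw, hx.trans hwx.symm, τ, hτ, ?_⟩
  simp only [Function.comp_apply, liftChart_coe] at hsub
  have h3 : chartAt Plane x (e.symm (e x + τ • u)) = e x + τ • u := e.right_inv h2
  rw [h3, add_sub_cancel_left] at hsub
  rw [hsub, add_sub_cancel]
  exact hw'

/-- Relative to the midpoint of a common edge with ends `±h`, the first triangle has apex `-u` and
the second has apex `y` on the side of `u`. The vectors `2h`, `u - h`, `u + h` are joined by `y + h`
or `y - h`. If both fail then `y = u`, the triangles form a parallelogram, and its diagonal `2u`
serves. -/
theorem exists_isHolonomyQuadruple (T : GeodesicTriangulation S ι) :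
    ∃ v : Fin 4 → Plane, IsHolonomyQuadruple S v := by
  obtain ⟨x₀⟩ : Nonempty S := inferInstance
  obtain ⟨k, -⟩ := T.cover (x₀ : Completion S)
  set z : Plane := (1 / 2 : ℝ) • T.vert k 1 + (1 / 2 : ℝ) • T.vert k 2 with hzdef
  set h : Plane := (1 / 2 : ℝ) • T.vert k 2 - (1 / 2 : ℝ) • T.vert k 1 with hhdef
  set u : Plane := z - T.vert k 0 with hudef
  have hk0 : T.vert k 0 = z - u := by rw [hudef]; abel
  have hk1 : T.vert k 1 = z - h := by rw [hzdef, hhdef]; module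
  have hk2 : T.vert k 2 = z + h := by rw [hzdef, hhdef]; module
  have hz : z ∈ T.edge k 0 := ⟨1 / 2, 1 / 2, by norm_num, by norm_num, by norm_num, rfl⟩
  have hd : det h u ≠ 0 := by
    intro h0
    apply det_ne_zero_of_affineIndependent (T.affineIndependent k) (i := 1) (j := 2) (l := 0)
      (by decide) (by decide) (by decide)
    have e1 : T.vert k 2 - T.vert k 1 = (2 : ℝ) • h := by rw [hk1, hk2]; module
    have e2 : T.vert k 0 - T.vert k 1 = h - u := by rw [hk0, hk1]; module
    rw [e1, e2, det_smul_left, det_sub_right, det_self, h0, sub_zero, mul_zero]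
  obtain ⟨l, w, hw, hzw, τ, hτ, hwτ⟩ := T.exists_adjacent hz u
  obtain ⟨x, hx⟩ := T.exists_coe_eq_map (T.edge_subset k 0 hz)
    (openSegment_notMem_range (T.affineIndependent k) (add_one_ne_add_two 0) hz)
  -- An interior `w` would force the triangle to be `k` itself, which has no points beyond the edge
  -- in direction `u`.
  have hwedge : ∃ m, w ∈ T.edge l m := by
    rcases mem_triangle_cases (T.affineIndependent l) hw with h1 | h1 | h1
    · exfalso
      obtain ⟨rfl, rfl⟩ := T.interior_inj l k w h1 z (T.edge_subset k 0 hz) hzw.symm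
      have := det_mul_det_nonneg (p := T.vert l) (i := 1) (j := 2) (l := 0) (by decide) hwτ
      have e1 : T.vert l 2 - T.vert l 1 = (2 : ℝ) • h := by rw [hk1, hk2]; module
      have e2 : T.vert l 0 - T.vert l 1 = h - u := by rw [hk0, hk1]; module
      have e3 : z + τ • u - T.vert l 1 = h + τ • u := by rw [hk1]; module
      rw [e1, e2, e3, det_smul_left, det_smul_left, det_sub_right, det_self, det_add_right,
        det_self, det_smul_right] at this
      have : 0 < τ * (det h u * det h u) := mul_pos hτ (mul_self_pos.2 hd)
      linarith
    · exact absurd h1 (T.notMem_range_vert (hzw.symm.trans hx))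
    · exact h1
  obtain ⟨m, hm⟩ := hwedge
  obtain ⟨i, j, hmi, hmj, hij, hall, hi, hj⟩ : ∃ i j : Fin 3, m ≠ i ∧ m ≠ j ∧ i ≠ j ∧
      (∀ n, n = i ∨ n = j ∨ n = m) ∧ T.vert l i = w - h ∧ T.vert l j = w + h := by
    have e1 : T.vert k 1 + (w - z) = w - h := by rw [hk1]; abel
    have e2 : T.vert k 2 + (w - z) = w + h := by rw [hk2]; abel
    rcases T.edge_translate hz hm hzw with ⟨h1, h2⟩ | ⟨h1, h2⟩
    · exact ⟨m + 1, m + 2, ne_add_one m, ne_add_two m, add_one_ne_add_two m,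
        fun n => by have := eq_or_eq_add n m; tauto, h1.trans e1, h2.trans e2⟩
    · exact ⟨m + 2, m + 1, ne_add_two m, ne_add_one m, (add_one_ne_add_two m).symm,
        fun n => by have := eq_or_eq_add n m; tauto, h2.trans e1, h1.trans e2⟩
  obtain ⟨y, hlm⟩ : ∃ y, T.vert l m = w + y := ⟨T.vert l m - w, by abel⟩
  -- The second triangle contains `w + τ • u`, so its apex lies on the side of `u`.
  have hside : 0 ≤ det h u * det h y := by
    have := det_mul_det_nonneg (p := T.vert l) (i := i) (j := j) (l := m) hall hwτ
    have e1 : T.vert l j - T.vert l i = (2 : ℝ) • h := by rw [hi, hj]; module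
    have e2 : T.vert l m - T.vert l i = h + y := by rw [hi, hlm]; module
    have e3 : w + τ • u - T.vert l i = h + τ • u := by rw [hi]; module
    rw [e1, e2, e3, det_smul_left, det_smul_left, det_add_right, det_self, det_add_right,
      det_self, det_smul_right] at this
    have h4 : 0 ≤ τ * (det h u * det h y) := by linarith
    exact nonneg_of_mul_nonneg_right h4 hτ
  have hd' : det h y ≠ 0 := by
    intro h0
    apply det_ne_zero_of_affineIndependent (T.affineIndependent l) hij hmi.symm hmj.symm
    have e1 : T.vert l j - T.vert l i = (2 : ℝ) • h := by rw [hi, hj]; module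
    have e2 : T.vert l m - T.vert l i = h + y := by rw [hi, hlm]; module
    rw [e1, e2, det_smul_left, det_add_right, det_self, h0, add_zero, mul_zero]
  have hv1 : IsHolonomyVector S ((2 : ℝ) • h) := by
    have := T.isHolonomyVector_edge k (i := 1) (j := 2) (by decide)
    rwa [show T.vert k 2 - T.vert k 1 = (2 : ℝ) • h by rw [hk1, hk2]; module] at this
  have hv2 : IsHolonomyVector S (u - h) := by
    have := T.isHolonomyVector_edge k (i := 0) (j := 1) (by decide)
    rwa [show T.vert k 1 - T.vert k 0 = u - h by rw [hk1, hk0]; module] at this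
  have hv3 : IsHolonomyVector S (u + h) := by
    have := T.isHolonomyVector_edge k (i := 0) (j := 2) (by decide)
    rwa [show T.vert k 2 - T.vert k 0 = u + h by rw [hk2, hk0]; module] at this
  have hv4 : IsHolonomyVector S (y + h) := by
    have := T.isHolonomyVector_edge l hmi.symm
    rwa [show T.vert l m - T.vert l i = y + h by rw [hi, hlm]; module] at this
  have hv5 : IsHolonomyVector S (y - h) := by
    have := T.isHolonomyVector_edge l hmj.symm
    rwa [show T.vert l m - T.vert l j = y - h by rw [hj, hlm]; module] at this
  have hfourth : ∀ v, IsHolonomyVector S v → det h v ≠ 0 → det (u - h) v ≠ 0 →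
      det (u + h) v ≠ 0 → ∃ v : Fin 4 → Plane, IsHolonomyQuadruple S v := by
    intro v hv h1 h2 h3
    refine ⟨_, isHolonomyQuadruple_of hv1 hv2 hv3 hv ?_ ?_ ?_ ?_ h2 h3⟩
    · rw [det_smul_left, det_sub_right, det_self, sub_zero]
      exact mul_ne_zero two_ne_zero hd
    · rw [det_smul_left, det_add_right, det_self, add_zero]
      exact mul_ne_zero two_ne_zero hd
    · rw [det_smul_left]
      exact mul_ne_zero two_ne_zero h1
    · rw [det_sub_left, det_add_right, det_add_right, det_self, det_self, det_swap u h]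
      intro h0
      apply hd
      linarith
  have e1 : det h (y + h) = det h y := by rw [det_add_right, det_self, add_zero]
  have e2 : det h (y - h) = det h y := by rw [det_sub_right, det_self, sub_zero]
  have e3 : det (u - h) (y + h) = det u y - det h u - det h y := by
    rw [det_sub_left, det_add_right, det_add_right, det_self, det_swap u h]; ring
  have e4 : det (u + h) (y + h) = det u y - det h u + det h y := by
    rw [det_add_left, det_add_right, det_add_right, det_self, det_swap u h]; ring
  have e5 : det (u - h) (y - h) = det u y + det h u - det h y := by
    rw [det_sub_left, det_sub_right u y h, det_sub_right h y h, det_self, det_swap u h]; ring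
  have e6 : det (u + h) (y - h) = det u y + det h u + det h y := by
    rw [det_add_left, det_sub_right u y h, det_sub_right h y h, det_self, det_swap u h]; ring
  by_cases hA : det (u - h) (y + h) ≠ 0 ∧ det (u + h) (y + h) ≠ 0
  · exact hfourth _ hv4 (by rwa [e1]) hA.1 hA.2
  by_cases hB : det (u - h) (y - h) ≠ 0 ∧ det (u + h) (y - h) ≠ 0
  · exact hfourth _ hv5 (by rwa [e2]) hB.1 hB.2
  rw [e3, e4] at hA
  rw [e5, e6] at hB
  have hpos : 0 < det h u * det h y := hside.lt_of_ne (mul_ne_zero hd hd').symm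
  -- Each of `y + h`, `y - h` is parallel to one of `u - h`, `u + h`. Two of the four combinations
  -- give `det h u = 0`, one puts `y` on the wrong side of the edge, and the remaining one gives `y
  -- = u`.
  have hsolve : det h y = det h u ∧ det u y = 0 := by
    have hA' : det u y - det h u - det h y = 0 ∨ det u y - det h u + det h y = 0 := by tauto
    have hB' : det u y + det h u - det h y = 0 ∨ det u y + det h u + det h y = 0 := by tauto
    rcases hA' with hA' | hA' <;> rcases hB' with hB' | hB'
    · exact absurd (by linarith) hd
    · have : det h y = -det h u := by linarith
      rw [this] at hpos
      nlinarith [mul_self_nonneg (det h u)]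
    · exact ⟨by linarith, by linarith⟩
    · exact absurd (by linarith) hd
  have hyu : y = u := by
    have := det_smul_eq h u y
    rw [hsolve.1, det_swap y u, hsolve.2, neg_zero, zero_smul, zero_add] at this
    exact smul_right_injective Plane hd this
  rw [hyu] at hlm
  refine hfourth _ (T.isHolonomyVector_diagonal hz hm hzw hk0 hlm) ?_ ?_ ?_
  · rw [det_smul_right]
    exact mul_ne_zero two_ne_zero hd
  · rw [det_smul_right, det_sub_left, det_self, zero_sub]
    exact mul_ne_zero two_ne_zero (neg_ne_zero.2 hd)
  · rw [det_smul_right, det_add_left, det_self, zero_add]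
    exact mul_ne_zero two_ne_zero hd

end GeodesicTriangulation

/-! ### Fields of definition -/

section Field

variable {K : Subfield ℝ} {a b : Plane}

theorem exists_det_eq_mul {v w : Plane} (hv : v ∈ Submodule.span K {a, b})
    (hw : w ∈ Submodule.span K {a, b}) : ∃ c : K, det v w = c * det a b := by
  obtain ⟨r, s, rfl⟩ := Submodule.mem_span_pair.1 hv
  obtain ⟨r', s', rfl⟩ := Submodule.mem_span_pair.1 hw
  refine ⟨r * s' - s * r', ?_⟩
  simp only [Subfield.smul_def, det, PiLp.add_apply, PiLp.smul_apply, smul_eq_mul]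
  push_cast
  ring

theorem mem_span_pair_of_eq {v : Plane} {r s : ℝ} (hr : r ∈ K) (hs : s ∈ K)
    (h : v = r • a + s • b) : v ∈ Submodule.span K {a, b} :=
  Submodule.mem_span_pair.2 ⟨⟨r, hr⟩, ⟨s, hs⟩, h.symm⟩

/-- Numerator and denominator are products of two determinants each, so the factors `det a b`
cancel. -/
theorem crossRatio_mem_of_mem_span (hab : det a b ≠ 0) {v : Fin 4 → Plane}
    (hv : ∀ i, v i ∈ Submodule.span K {a, b}) :
    crossRatio (v 0) (v 1) (v 2) (v 3) ∈ K := by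
  obtain ⟨c₁, h₁⟩ := exists_det_eq_mul (hv 0) (hv 2)
  obtain ⟨c₂, h₂⟩ := exists_det_eq_mul (hv 1) (hv 3)
  obtain ⟨c₃, h₃⟩ := exists_det_eq_mul (hv 1) (hv 2)
  obtain ⟨c₄, h₄⟩ := exists_det_eq_mul (hv 0) (hv 3)
  have : crossRatio (v 0) (v 1) (v 2) (v 3) = ((c₁ * c₂ / (c₃ * c₄) : K) : ℝ) := by
    rw [crossRatio, h₁, h₂, h₃, h₄, mul_mul_mul_comm, mul_mul_mul_comm (c₃ : ℝ),
      mul_div_mul_right _ _ (mul_ne_zero hab hab)]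
    push_cast
    rfl
  rw [this]
  exact SetLike.coe_mem _

theorem isCoefficientField_iff_le_span {Λ : AddSubgroup Plane} (ha : a ∈ Λ) (hb : b ∈ Λ)
    (hab : det a b ≠ 0) :
    IsCoefficientField Λ K ↔ (Λ : Set Plane) ⊆ Submodule.span K {a, b} := by
  refine isCoefficientField_iff ?_ ?_ ?_
  · rintro v (rfl | rfl) <;> assumption
  · intro v _
    refine Submodule.mem_span_pair.2 ⟨det v b / det a b, det a v / det a b, ?_⟩
    have h := det_smul_eq a b v
    rw [div_eq_inv_mul, div_eq_inv_mul, mul_smul, mul_smul, ← smul_add, ← h, smul_smul,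
      inv_mul_cancel₀ hab, one_smul]
  · have := (linearIndependent_of_det_ne_zero hab).linearIndepOn_id
    rw [Matrix.range_cons_cons_empty] at this
    exact this

end Field

/-! ### Directions and triangles over the field of cross ratios -/

variable {S : Type*} [MetricSpace S] [ChartedSpace Plane S]

theorem crossRatio_mem_crossRatioField {a b c d : Plane}
    (h : IsHolonomyQuadruple S ![a, b, c, d]) : crossRatio a b c d ∈ crossRatioField S :=
  Subfield.subset_closure ⟨_, h, rfl⟩

/-- If `a`, `b` and `b - a` are holonomy vectors, then all holonomy vectors are, up to a factor,
combinations of `a` and `b` with coefficients in the field of cross ratios. -/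
theorem IsHolonomyVector.exists_eq_smul {a b v : Plane} (hv : IsHolonomyVector S v)
    (ha : IsHolonomyVector S a) (hb : IsHolonomyVector S b) (hba : IsHolonomyVector S (b - a))
    (hab : det a b ≠ 0) :
    ∃ c : ℝ, ∃ g ∈ Submodule.span (crossRatioField S) {a, b}, v = c • g := by
  have hamem : a ∈ Submodule.span (crossRatioField S) {a, b} := Submodule.subset_span (by simp)
  have hbmem : b ∈ Submodule.span (crossRatioField S) {a, b} := Submodule.subset_span (by simp)
  by_cases h1 : det a v = 0
  · obtain ⟨c, hc⟩ := exists_eq_smul_of_det_eq_zero ha.1 h1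
    exact ⟨c, a, hamem, hc⟩
  by_cases h2 : det b v = 0
  · obtain ⟨c, hc⟩ := exists_eq_smul_of_det_eq_zero hb.1 h2
    exact ⟨c, b, hbmem, hc⟩
  by_cases h3 : det (b - a) v = 0
  · obtain ⟨c, hc⟩ := exists_eq_smul_of_det_eq_zero hba.1 h3
    exact ⟨c, b - a, Submodule.sub_mem _ hbmem hamem, hc⟩
  have e1 : det a (b - a) = det a b := by rw [det_sub_right, det_self, sub_zero]
  have e2 : det b (b - a) = det a b := by rw [det_sub_right, det_self, det_swap b a]; ring
  -- The cross ratio `(a, b; b - a, v)` simplifies to `det b v / det a v`, which by Cramer's rule is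
  -- minus the ratio of the coordinates of `v`.
  have hρ := crossRatio_mem_crossRatioField (isHolonomyQuadruple_of ha hb hba hv hab
    (by rwa [e1]) h1 (by rwa [e2]) h2 h3)
  rw [crossRatio, e1, e2, mul_div_mul_left _ _ hab] at hρ
  refine ⟨det a v / det a b, (-(det b v / det a v)) • a + (1 : ℝ) • b,
    mem_span_pair_of_eq (neg_mem hρ) (one_mem _) rfl, ?_⟩
  have h := det_smul_eq a b v
  have h' : v = (det a b)⁻¹ • (det v b • a + det a v • b) := by
    rw [← h, smul_smul, inv_mul_cancel₀ hab, one_smul]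
  refine h'.trans ?_
  rw [det_swap v b, smul_add, smul_add, smul_smul, smul_smul, smul_smul, smul_smul]
  congr 2 <;> field_simp

namespace GeodesicTriangulation

variable {ι : Type*} (T : GeodesicTriangulation S ι)

/-- If one edge of a triangle has coordinates in the field of cross ratios, then all have. -/
theorem vert_sub_vert_mem_span {a b : Plane} (ha : IsHolonomyVector S a)
    (hb : IsHolonomyVector S b) (hba : IsHolonomyVector S (b - a)) (hab : det a b ≠ 0)
    {k : ι} {m : Fin 3}
    (hm : T.vert k (m + 2) - T.vert k (m + 1) ∈ Submodule.span (crossRatioField S) {a, b})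
    (i j : Fin 3) :
    T.vert k j - T.vert k i ∈ Submodule.span (crossRatioField S) {a, b} := by
  obtain ⟨μ, g, hg, hμ⟩ := (T.isHolonomyVector_edge k (ne_add_one m).symm).exists_eq_smul
    ha hb hba hab
  obtain ⟨ν, g', hg', hν⟩ := (T.isHolonomyVector_edge k (ne_add_two m).symm).exists_eq_smul
    ha hb hba hab
  have hne := det_ne_zero_of_affineIndependent (T.affineIndependent k) (ne_add_one m)
    (ne_add_two m) (add_one_ne_add_two m)
  have hgg' : det g' g ≠ 0 := by
    intro h0
    apply hne
    rw [← neg_sub (T.vert k m), ← neg_sub (T.vert k m) (T.vert k (m + 2)), hμ, hν, ← smul_neg,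
      ← smul_neg, det_smul_left, det_smul_right]
    have : det (-g) (-g') = -det g' g := by simp only [det, PiLp.neg_apply]; ring
    rw [this, h0]
    simp
  have hdiff : T.vert k (m + 2) - T.vert k (m + 1) = μ • g - ν • g' := by
    rw [← hμ, ← hν]; abel
  obtain ⟨c, hc⟩ := exists_det_eq_mul hg' hm
  obtain ⟨c', hc'⟩ := exists_det_eq_mul hg' hg
  -- Pairing the given side with `g'` eliminates `ν` and presents `μ` as a quotient of two
  -- determinants, both multiples of `det a b` by elements of the field.
  have hμK : μ = ((c / c' : crossRatioField S) : ℝ) := by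
    have h1 : det g' (T.vert k (m + 2) - T.vert k (m + 1)) = μ * det g' g := by
      rw [hdiff, det_sub_right, det_smul_right, det_smul_right, det_self, mul_zero, sub_zero]
    rw [hc, hc'] at h1
    have hc'0 : (c' : ℝ) ≠ 0 := by
      intro h0
      rw [hc', h0, zero_mul] at hgg'
      exact hgg' rfl
    push_cast
    rw [eq_div_iff hc'0]
    exact mul_right_cancel₀ hab (by rw [h1]; ring)
  have h1 : T.vert k m - T.vert k (m + 1) ∈ Submodule.span (crossRatioField S) {a, b} := by
    rw [hμ, hμK]
    exact Submodule.smul_mem _ (c / c') hg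
  have key : ∀ i, T.vert k i - T.vert k (m + 1) ∈
      Submodule.span (crossRatioField S) {a, b} := by
    intro i
    rcases eq_or_eq_add i m with rfl | rfl | rfl
    · exact h1
    · rw [sub_self]
      exact zero_mem _
    · exact hm
  have := Submodule.sub_mem _ (key j) (key i)
  rwa [sub_sub_sub_cancel_right] at this

/-! ### Propagation across edges and equality of the fields -/

variable [TranslationSurface S]

/-- A union of triangles is closed in the surface. -/
theorem isClosed_setOf_exists_mem (P : ι → Prop) :
    IsClosed {x : S | ∃ k, P k ∧ ∃ z ∈ T.triangle k, T.map k z = x} := by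
  rw [← isOpen_compl_iff, isOpen_iff_mem_nhds]
  intro x hx
  filter_upwards [eventually_nhds_coe.1
    (T.eventually_exists (isFlatCoordinate_liftChart x) (mem_chartDomain x))] with y hy
  rintro ⟨k, hk, w, hw, hwy⟩
  obtain ⟨z, hz, hzx, -⟩ := hy k w hw hwy
  exact hx ⟨k, hk, z, hz, hzx⟩

/-- A property of triangles that is inherited across shared edges holds for all triangles. -/
theorem forall_of_shared_edge {P : ι → Prop} {k₀ : ι} (h₀ : P k₀)
    (h : ∀ k l j m z w, z ∈ T.edge k j → w ∈ T.edge l m → T.map k z = T.map l w → P k → P l)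
    (l : ι) : P l := by
  by_contra hl
  have hne : ∀ k, ∃ x : S, ∃ z ∈ T.triangle k, T.map k z = x := by
    intro k
    have hz : (1 / 2 : ℝ) • T.vert k (0 + 1) + (1 / 2 : ℝ) • T.vert k (0 + 2) ∈ T.edge k 0 :=
      ⟨1 / 2, 1 / 2, by norm_num, by norm_num, by norm_num, rfl⟩
    obtain ⟨x, hx⟩ := T.exists_coe_eq_map (T.edge_subset k 0 hz)
      (openSegment_notMem_range (T.affineIndependent k) (add_one_ne_add_two 0) hz)
    exact ⟨x, _, T.edge_subset k 0 hz, hx⟩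
  -- The triangles with `P` and those without it cover `S` by two non-empty closed sets, which meet
  -- by connectedness. At a common point two different triangles share an edge.
  obtain ⟨x, -, ⟨k, hk, z, hz, hzx⟩, ⟨k', hk', z', hz', hzx'⟩⟩ :=
    isPreconnected_closed_iff.1 (isPreconnected_univ (α := S)) _ _
      (T.isClosed_setOf_exists_mem P) (T.isClosed_setOf_exists_mem fun k => ¬ P k)
      (fun x _ => by
        obtain ⟨k, z, hz, hzx⟩ := T.cover (x : Completion S)
        by_cases hk : P k
        · exact Or.inl ⟨k, hk, z, hz, hzx⟩
        · exact Or.inr ⟨k, hk, z, hz, hzx⟩)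
      (by
        obtain ⟨x, hx⟩ := hne k₀
        exact ⟨x, trivial, k₀, h₀, hx⟩)
      (by
        obtain ⟨x, hx⟩ := hne l
        exact ⟨x, trivial, l, hl, hx⟩)
  rcases T.eq_or_mem_edge hz hz' hzx hzx' with ⟨rfl, -⟩ | ⟨j, m, hj, hm⟩
  · exact hk' hk
  · exact hk' (h k k' j m z z' hj hm (hzx.trans hzx'.symm) hk)

theorem crossRatioField_eq_segmentField (T : GeodesicTriangulation S ι) (hS : IsTame S) :
    crossRatioField S = segmentField S := by
  obtain ⟨x₀⟩ : Nonempty S := inferInstance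
  obtain ⟨k₀, -⟩ := T.cover (x₀ : Completion S)
  set a := T.vert k₀ 1 - T.vert k₀ 0 with ha_def
  set b := T.vert k₀ 2 - T.vert k₀ 0 with hb_def
  have ha : IsHolonomyVector S a := T.isHolonomyVector_edge k₀ (by decide)
  have hb : IsHolonomyVector S b := T.isHolonomyVector_edge k₀ (by decide)
  have hba : IsHolonomyVector S (b - a) := by
    have := T.isHolonomyVector_edge k₀ (i := 1) (j := 2) (by decide)
    rwa [← sub_sub_sub_cancel_right _ _ (T.vert k₀ 0)] at this
  have hab : det a b ≠ 0 := det_ne_zero_of_affineIndependent (T.affineIndependent k₀)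
    (by decide) (by decide) (by decide)
  have haΛ := ha.mem_relativeHolonomy hS
  have hbΛ := hb.mem_relativeHolonomy hS
  apply le_antisymm
  · refine (Subfield.closure_le).2 ?_
    rintro _ ⟨v, hv, rfl⟩
    -- The smallest coefficient field is itself a coefficient field, so `Λ` has coordinates in it.
    have h := (isCoefficientField_iff_le_span haΛ hbΛ hab).1
      (isLeast_coefficientField (relativeHolonomy S)).1
    exact crossRatio_mem_of_mem_span hab fun i => h ((hv.1 i).mem_relativeHolonomy hS)
  · refine sInf_le ((isCoefficientField_iff_le_span haΛ hbΛ hab).2 ?_)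
    set V := Submodule.span (crossRatioField S) {a, b}
    have hedge : ∀ k i j, T.vert k j - T.vert k i ∈ V := by
      refine T.forall_of_shared_edge (P := fun k => ∀ i j, T.vert k j - T.vert k i ∈ V)
        (k₀ := k₀) ?_ ?_
      · refine T.vert_sub_vert_mem_span ha hb hba hab (m := 2) ?_
        exact Submodule.subset_span (Or.inl rfl)
      · intro k l j m z w hz hw h hk
        -- Modulo `3`, the side opposite to vertex `2` runs from vertex `0` to vertex `1`, so it is
        -- `a`.
        refine T.vert_sub_vert_mem_span ha hb hba hab (m := m) ?_
        rcases T.edge_translate hz hw h with ⟨h1, h2⟩ | ⟨h1, h2⟩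
        · rw [h1, h2, add_sub_add_right_eq_sub]
          exact hk _ _
        · rw [h1, h2, add_sub_add_right_eq_sub]
          exact hk _ _
    have hle : T.edgeGroup ≤ V.toAddSubgroup := by
      refine (AddSubgroup.closure_le _).2 ?_
      rintro _ ⟨k, i, j, rfl⟩
      exact hedge k i j
    exact fun v hv => hle (T.relativeHolonomy_le hS hv)

end GeodesicTriangulation

end FlatSurface

end

open FlatSurface in
theorem mainTheorem6 {S : Type*} [MetricSpace S] [ChartedSpace Plane S] [TranslationSurface S]
    (hS : IsTame S) {ι : Type*} [Countable ι] (T : GeodesicTriangulation S ι) :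
    (∃ v : Fin 4 → Plane, IsHolonomyQuadruple S v) ∧
      crossRatioField S = segmentField S := by
  exact ⟨T.exists_isHolonomyQuadruple, T.crossRatioField_eq_segmentField hS⟩
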